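/- All spaces are $\Delta$-generated, $k_\Delta$ denotes $\Delta$-kelleyfication (the coreflection of topological spaces onto $\Delta$-generated spaces), and products of spaces are taken in the category of $\Delta$-generated spaces. A \emph{precubical set} $K$ is a presheaf of sets on the box category $\square$, the subcategory of sets with objects $[n]=\{0,1\}^n$ ($n\ge 0$) generated by the coface maps $\delta_i^{\alpha}:[n-1]\to[n]$ inserting $\alpha\in\{0,1\}$ at place $i$; $K_n=K([n])$ is the set of $n$-cubes. A \emph{multipointed $d$-space} $X$ is a space $|X|$ with a subset $X^0$ of states and a set of continuous paths $[0,1]\to|X|$ between states, the execution paths, closed under reparametrization by the group $\mathcal G(1,1)$ of nondecreasing homeomorphisms of $[0,1]$ and under normalized composition $*_N$ (each of the two paths is run in time $1/2$). Maps are the continuous maps preserving states and execution paths. $\mathbb P^{top}_{\alpha,\beta}X$ is the set of execution paths from $\alpha$ to $\beta$ with the topology $k_\Delta$ of the relative compact-open topology. A \emph{flow} is a small semicategory (category without identities) enriched over $\Delta$-generated spaces; maps of flows are the enriched semifunctors. \emph{Categorization.} For a multipointed $d$-space $X$, the flow $\mathrm{Cat}(X)$ has set of states $X^0$; its space of execution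 paths from $\alpha$ to $\beta$ is the quotient of $\mathbb P^{top}_{\alpha,\beta}X$ that identifies $c$ with $c\phi$ for all $\phi\in\mathcal G(1,1)$; composition is induced by $*_N$. This is a functor from multipointed $d$-spaces to flows. \emph{Tame regular realization.} The regular $n$-cube has underlying space $[0,1]^n$ and set of states $\{0,1\}^n$; its execution paths from $a$ to $b$ are, if $a<b$ (product order), the continuous paths from $a$ to $b$ that are nondecreasing in each coordinate and regular (without stop interval, i.e. without maximal nondegenerate interval on which the path is constant), and there are none if $a\not<b$. The regular cubes form a functor from $\square$ to multipointed $d$-spaces, the coface maps acting by insertion of a coordinate $0$ or $1$. Put $|K|^t_{reg}=\varinjlim_{\square[n]\to K}|\square[n]|^t_{reg}$, the colimit in multipointed $d$-spaces, over all cubes of $K$, of the regular cubes. Its underlying space is the geometric realization $|K|_{geom}=\varinjlim_{\square[n]\to K}[0,1]^n$. \emph{Tame concrete realization.} A $d$-path of $K$ is a finite Moore composition of paths $|c|_{geom}\circ\delta$, where $c\in K_n$ is a cube and $\delta:[0,\ell]\to[0,1]^n$ is continuous and nondecreasing in each coordinate; its $L_1$-arc length is the sum over the pieces of $\sum_i|\delta_i(\ell)-\delta_i(0)|$.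 For $\alpha,\beta\in K_0$ and an integer $n\ge1$, let $\vec N^n_{\alpha,\beta}(K)$ be the set of paths $\gamma:[0,n]\to|K|_{geom}$ of the form $\gamma(t)=p(t/n)$ with $p$ an execution path of $|K|^t_{reg}$ from $\alpha$ to $\beta$, such that for every $t\in[0,n]$ the $L_1$-arc length of $\gamma|_{[0,t]}$ is $t$; it carries the topology $k_\Delta$ of the relative compact-open topology. The flow $|K|_{tc}$ has set of states $K_0$, spaces of execution paths $\mathbb P_{\alpha,\beta}|K|_{tc}=\coprod_{n\ge1}\vec N^n_{\alpha,\beta}(K)$, and composition induced by the Moore composition (concatenation with addition of lengths). \textbf{Proposition.} There is an isomorphism of flows $\mathrm{Cat}(|K|^t_{reg})\cong|K|_{tc}$ for every precubical set $K$, natural in $K$; that is, the functors $K\mapsto\mathrm{Cat}(|K|^t_{reg})$ and $K\mapsto|K|_{tc}$ from precubical sets to flows are naturally isomorphic. -/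

import Mathlib

open CategoryTheory CategoryTheory.Limits Topology
open scoped unitInterval

universe u

noncomputable section

namespace DirectedSpace

/-! ## Delta-generated spaces -/

/-- `g` is continuous for the `Δ`-kelleyfications of the topologies of `Y` and `Z`
(see `Topology.continuousGeneratedBy_iff`). Applied to `Y = A × B` with the product topology this
is continuity on the product of `A` and `B` in the category of `Δ`-generated spaces. -/
abbrev DeltaContinuous {Y Z : Type*} [TopologicalSpace Y] [TopologicalSpace Z] (g : Y → Z) :
    Prop :=
  ContinuousGeneratedBy (fun n : ℕ ↦ Fin n → ℝ) g

instance deltaGenerated_prod (i j : ℕ) : DeltaGeneratedSpace ((Fin i → ℝ) × (Fin j → ℝ)) :=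
  (((Homeomorph.piCongrLeft (Y := fun _ ↦ ℝ) finSumFinEquiv).symm.trans
    Homeomorph.sumArrowHomeomorphProdArrow).isQuotientMap).isGeneratedBy

instance deltaGenerated_cube (n : ℕ) : DeltaGeneratedSpace (ULift.{u} (Fin n → I)) := by
  have h : IsQuotientMap
      (fun x : Fin n → ℝ ↦ (ULift.up (fun i ↦ Set.projIcc 0 1 zero_le_one (x i)) :
        ULift.{u} (Fin n → I))) := by
    refine IsQuotientMap.of_inverse (f := fun (y : ULift.{u} (Fin n → I)) i ↦ (y.down i : ℝ)) ?_ ?_ ?_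
    · exact continuous_pi fun i ↦ continuous_subtype_val.comp
        ((continuous_apply i).comp continuous_uliftDown)
    · refine continuous_uliftUp.comp ?_
      exact continuous_pi fun i ↦ continuous_projIcc.comp (continuous_apply i)
    · intro y
      ext i
      simp
  exact h.isGeneratedBy

theorem DeltaContinuous.continuous {Y Z : Type*} [TopologicalSpace Y] [TopologicalSpace Z]
    [DeltaGeneratedSpace Y] {g : Y → Z} (hg : DeltaContinuous g) : Continuous g :=
  (IsGeneratedBy.continuous_iff (fun n : ℕ ↦ Fin n → ℝ) g).2 hg

/-- Descent of `Δ`-continuity along a quotient map in the second variable. -/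
theorem DeltaContinuous.descend_right {A B B' C : Type*} [TopologicalSpace A] [TopologicalSpace B]
    [TopologicalSpace B'] [TopologicalSpace C] [DeltaGeneratedSpace B] {q : B → B'}
    (hq : IsQuotientMap q) {g : A × B' → C}
    (hg : DeltaContinuous (fun p : A × B ↦ g (p.1, q p.2))) : DeltaContinuous g := by
  let G : ContinuousMapGeneratedBy (fun n : ℕ ↦ Fin n → ℝ) (A × B) C := ⟨_, hg⟩
  have hs : ∀ b', DeltaContinuous (fun a : A ↦ g (a, b')) := by
    intro b'
    obtain ⟨b, rfl⟩ := hq.surjective b'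
    exact (ContinuousMapGeneratedBy.curryEquiv G b).prop
  let H : B' → ContinuousMapGeneratedBy (fun n : ℕ ↦ Fin n → ℝ) A C := fun b' ↦ ⟨_, hs b'⟩
  have hH : DeltaContinuous H := by
    have h1 : DeltaContinuous (H ∘ q) := (ContinuousMapGeneratedBy.curryEquiv G).prop
    have h2 : Continuous (H ∘ q) := DeltaContinuous.continuous h1
    exact ((hq.continuous_iff).2 h2).continuousGeneratedBy
  exact (ContinuousMapGeneratedBy.curryEquiv.symm ⟨H, hH⟩).prop

theorem DeltaContinuous.descend {A A' B B' C : Type*} [TopologicalSpace A] [TopologicalSpace A']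
    [TopologicalSpace B] [TopologicalSpace B'] [TopologicalSpace C] [DeltaGeneratedSpace A]
    [DeltaGeneratedSpace B] {p : A → A'} (hp : IsQuotientMap p) {q : B → B'}
    (hq : IsQuotientMap q) {g : A' × B' → C}
    (hg : DeltaContinuous (fun x : A × B ↦ g (p x.1, q x.2))) : DeltaContinuous g := by
  refine DeltaContinuous.descend_right hq ?_
  have h1 : DeltaContinuous (fun x : B × A ↦ g (p x.2, q x.1)) :=
    ContinuousGeneratedBy.comp hg continuous_swap.continuousGeneratedBy
  have h2 : DeltaContinuous (fun x : B × A' ↦ g (x.2, q x.1)) :=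
    DeltaContinuous.descend_right (g := fun x : B × A' ↦ g (x.2, q x.1)) hp h1
  exact ContinuousGeneratedBy.comp h2 continuous_swap.continuousGeneratedBy

/-! ## Regular paths and reparametrizations -/

section Paths

variable {X : Type*} [TopologicalSpace X]

/-- The path is constant on the interval `[a, b]`. -/
def ConstantOn (γ : I → X) (a b : I) : Prop := ∀ s ∈ Set.Icc a b, ∀ t ∈ Set.Icc a b, γ s = γ t

/-- A stop interval: a nondegenerate interval on which the path is constant, maximal for this
property. -/
def IsStopInterval (γ : I → X) (a b : I) : Prop :=
  a < b ∧ ConstantOn γ a b ∧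
    ∀ a' b' : I, a' ≤ a → b ≤ b' → ConstantOn γ a' b' → a' = a ∧ b' = b

/-- A path is regular if it has no stop interval. -/
def IsRegular (γ : I → X) : Prop := ∀ a b : I, ¬ IsStopInterval γ a b

theorem isRegular_iff [T1Space X] {γ : I → X} (hγ : Continuous γ) :
    IsRegular γ ↔ ∀ a b : I, a < b → ¬ ConstantOn γ a b := by
  refine ⟨fun h a b hab hc ↦ ?_, fun h a b hs ↦ h a b hs.1 hs.2.1⟩
  have ha : a ∈ Set.Icc a b := ⟨le_rfl, hab.le⟩
  have key : ∀ s t : I, s ≤ a → b ≤ t → (ConstantOn γ s t ↔ ∀ r ∈ Set.Icc s t, γ r = γ a) := by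
    intro s t hs ht
    refine ⟨fun hh r hr ↦ hh r hr a ⟨hs, hab.le.trans ht⟩, fun hh r hr r' hr' ↦ ?_⟩
    rw [hh r hr, hh r' hr']
  have hcl : IsClosed (γ ⁻¹' {γ a}) := isClosed_singleton.preimage hγ
  let A : Set I := {s | s ≤ a ∧ ∀ r ∈ Set.Icc s a, γ r = γ a}
  let B : Set I := {t | b ≤ t ∧ ∀ r ∈ Set.Icc b t, γ r = γ a}
  have hmid : ∀ r ∈ Set.Icc a b, γ r = γ a := fun r hr ↦ hc r hr a ha
  have haA : a ∈ A := ⟨le_rfl, fun r hr ↦ by rw [le_antisymm hr.2 hr.1]⟩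
  have hbB : b ∈ B := ⟨le_rfl, fun r hr ↦ by
    rw [le_antisymm hr.2 hr.1]; exact hmid b ⟨hab.le, le_rfl⟩⟩
  let a₀ := sInf A
  let b₀ := sSup B
  have ha₀ : a₀ ≤ a := sInf_le haA
  have hb₀ : b ≤ b₀ := le_sSup hbB
  have h1 : ∀ r, a₀ < r → r ≤ a → γ r = γ a := by
    intro r hr hra
    obtain ⟨s, hs, hsr⟩ := sInf_lt_iff.1 hr
    exact hs.2 r ⟨hsr.le, hra⟩
  have h2 : ∀ r, r < b₀ → b ≤ r → γ r = γ a := by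
    intro r hr hrb
    obtain ⟨s, hs, hsr⟩ := lt_sSup_iff.1 hr
    exact hs.2 r ⟨hrb, hsr.le⟩
  have h3 : ∀ r ∈ Set.Ioo a₀ b₀, γ r = γ a := by
    intro r hr
    rcases le_or_gt r a with h' | h'
    · exact h1 r hr.1 h'
    · rcases le_or_gt r b with h'' | h''
      · exact hmid r ⟨h'.le, h''⟩
      · exact h2 r hr.2 h''.le
  have hlt : a₀ < b₀ := ha₀.trans_lt (hab.trans_le hb₀)
  have h4 : ∀ r ∈ Set.Icc a₀ b₀, γ r = γ a := by
    intro r hr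
    have : closure (Set.Ioo a₀ b₀) ⊆ γ ⁻¹' {γ a} := closure_minimal h3 hcl
    rw [closure_Ioo hlt.ne] at this
    exact this hr
  refine h a₀ b₀ ⟨hlt, (key _ _ ha₀ hb₀).2 h4, fun a' b' ha' hb' hc' ↦ ?_⟩
  have hc'' := (key a' b' (ha'.trans ha₀) (hb₀.trans hb')).1 hc'
  refine ⟨le_antisymm ha' (sInf_le ⟨ha'.trans ha₀, fun r hr ↦ hc'' r ⟨hr.1, ?_⟩⟩),
    le_antisymm (le_sSup ⟨hb₀.trans hb', fun r hr ↦ hc'' r ⟨?_, hr.2⟩⟩) hb'⟩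
  · exact hr.2.trans (hab.le.trans (hb₀.trans hb'))
  · exact (ha'.trans (ha₀.trans hab.le)).trans hr.1

/-- Composition of a path with a nondecreasing homeomorphism of `[0,1]` onto itself. Nondecreasing
homeomorphisms of `[0,1]` and order automorphisms of `[0,1]` are the same thing. -/
def reparam {x y : X} (γ : Path x y) (φ : I ≃o I) : Path x y :=
  γ.reparam φ φ.continuous (OrderIso.map_bot φ) (OrderIso.map_top φ)

@[simp]
theorem reparam_apply {x y : X} (γ : Path x y) (φ : I ≃o I) (t : I) :
    reparam γ φ t = γ (φ t) := rfl

/-- A strictly increasing continuous self-map of `[0,1]` that fixes the end points. -/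
def autOfStrictMono (f : I → I) (hc : Continuous f) (hm : StrictMono f) (h0 : f 0 = 0)
    (h1 : f 1 = 1) : I ≃o I :=
  StrictMono.orderIsoOfSurjective f hm (fun y ↦ by
    have := intermediate_value_Icc (zero_le_one : (0 : I) ≤ 1) hc.continuousOn
    rw [h0, h1] at this
    obtain ⟨x, -, hx⟩ := this ⟨unitInterval.nonneg y, unitInterval.le_one y⟩
    exact ⟨x, hx⟩)

@[simp]
theorem autOfStrictMono_apply (f : I → I) (hc : Continuous f) (hm : StrictMono f) (h0 : f 0 = 0)
    (h1 : f 1 = 1) (t : I) : autOfStrictMono f hc hm h0 h1 t = f t := rfl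

/-- An order automorphism of `[0,1]` from a real function. -/
def autOfReal (f : ℝ → ℝ) (hc : Continuous f) (hm : StrictMonoOn f (Set.Icc 0 1)) (h0 : f 0 = 0)
    (h1 : f 1 = 1) : I ≃o I :=
  autOfStrictMono (fun t ↦ ⟨f t, by
      have h := hm.monotoneOn (Set.left_mem_Icc.2 zero_le_one) t.2 t.2.1
      have h' := hm.monotoneOn t.2 (Set.right_mem_Icc.2 zero_le_one) t.2.2
      rw [h0] at h; rw [h1] at h'; exact ⟨h, h'⟩⟩)
    (by fun_prop) (fun s t hst ↦ hm s.2 t.2 hst) (Subtype.ext h0) (Subtype.ext h1)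

@[simp]
theorem autOfReal_apply (f : ℝ → ℝ) (hc : Continuous f) (hm : StrictMonoOn f (Set.Icc 0 1))
    (h0 : f 0 = 0) (h1 : f 1 = 1) (t : I) : (autOfReal f hc hm h0 h1 t : ℝ) = f t := rfl

theorem trans_reparam {x y z : X} (γ₁ : Path x y) (γ₂ : Path y z) (φ ψ : I ≃o I) :
    ∃ χ : I ≃o I, (reparam γ₁ φ).trans (reparam γ₂ ψ) = reparam (γ₁.trans γ₂) χ := by
  let p : Path (0 : I) 1 := reparam Path.id φ
  let q : Path (0 : I) 1 := reparam Path.id ψ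
  have hp : ∀ t : I, p t = φ t := fun t ↦ rfl
  have hq : ∀ t : I, q t = ψ t := fun t ↦ rfl
  let f : ℝ → ℝ := fun t ↦ if t ≤ 1 / 2 then (p.extend (2 * t) : ℝ) / 2
    else (1 + (q.extend (2 * t - 1) : ℝ)) / 2
  have hf1 : ∀ t : ℝ, (h : t ∈ Set.Icc (0:ℝ) (1/2)) →
      f t = (φ ⟨2 * t, by constructor <;> linarith [h.1, h.2]⟩ : ℝ) / 2 := by
    intro t h
    have : (2 * t) ∈ Set.Icc (0:ℝ) 1 := by constructor <;> linarith [h.1, h.2]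
    simp only [f, if_pos h.2, Path.extend_apply _ this, hp]
  have hf2 : ∀ t : ℝ, (h : t ∈ Set.Ioc (1/2 : ℝ) 1) →
      f t = (1 + (ψ ⟨2 * t - 1, by constructor <;> linarith [h.1, h.2]⟩ : ℝ)) / 2 := by
    intro t h
    have : (2 * t - 1) ∈ Set.Icc (0:ℝ) 1 := by constructor <;> linarith [h.1, h.2]
    simp only [f, if_neg (not_le.2 h.1), Path.extend_apply _ this, hq]
  have hψ0 : ∀ s : I, 0 < (s : ℝ) → 0 < (ψ s : ℝ) := by
    intro s hs
    have : ψ ⊥ < ψ s := ψ.strictMono hs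
    rw [OrderIso.map_bot] at this
    exact this
  have hcont : Continuous f := by
    refine Continuous.if_le ?_ ?_ continuous_id continuous_const ?_
    · fun_prop
    · fun_prop
    · intro t ht
      have ht' : t = 1 / 2 := ht
      subst ht'
      norm_num
  have hmono : StrictMonoOn f (Set.Icc 0 1) := by
    intro s hs t ht hst
    rcases le_or_gt t (1 / 2) with h | h
    · rw [hf1 s ⟨hs.1, hst.le.trans h⟩, hf1 t ⟨ht.1, h⟩]
      have := φ.strictMono (a := ⟨2 * s, by constructor <;> linarith [hs.1]⟩)
        (b := ⟨2 * t, by constructor <;> linarith [ht.1]⟩)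
        (show 2 * s < 2 * t by linarith)
      have h2 := Subtype.coe_lt_coe.2 this
      linarith
    · rw [hf2 t ⟨h, ht.2⟩]
      rcases le_or_gt s (1 / 2) with h' | h'
      · rw [hf1 s ⟨hs.1, h'⟩]
        have h3 := (φ ⟨2 * s, by constructor <;> linarith [hs.1]⟩).2.2
        have h4 := hψ0 ⟨2 * t - 1, by constructor <;> linarith [ht.2]⟩
          (show 0 < 2 * t - 1 by linarith)
        linarith
      · rw [hf2 s ⟨h', hs.2⟩]
        have := ψ.strictMono (a := ⟨2 * s - 1, by constructor <;> linarith [hs.2]⟩)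
          (b := ⟨2 * t - 1, by constructor <;> linarith [ht.2]⟩)
          (show 2 * s - 1 < 2 * t - 1 by linarith)
        have h2 := Subtype.coe_lt_coe.2 this
        linarith
  have h0 : f 0 = 0 := by simp [f]
  have h1 : f 1 = 1 := by
    have : ¬ ((1 : ℝ) ≤ 1 / 2) := by norm_num
    simp only [f, if_neg this]
    norm_num
  refine ⟨autOfReal f hcont hmono h0 h1, ?_⟩
  ext t
  have e : ∀ (r : Path x z) (s : I), r s = r.extend s := fun r s ↦ by simp
  rw [reparam_apply, e, e, autOfReal_apply]
  rcases le_or_gt (t : ℝ) (1 / 2) with h | h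
  · rw [Path.extend_trans_of_le_half _ _ h]
    have ht : (t : ℝ) ∈ Set.Icc (0:ℝ) (1/2) := ⟨t.2.1, h⟩
    have hm : (2 * (t:ℝ)) ∈ Set.Icc (0:ℝ) 1 := by constructor <;> linarith [ht.1, ht.2]
    have hle : f t ≤ 1 / 2 := by
      rw [hf1 _ ht]; linarith [(φ ⟨2 * (t:ℝ), hm⟩).2.2]
    rw [Path.extend_trans_of_le_half _ _ hle, hf1 _ ht, Path.extend_apply _ hm, reparam_apply,
      mul_div_cancel₀ _ (two_ne_zero), Path.extend_extends']
  · rw [Path.extend_trans_of_half_le _ _ h.le]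
    have ht : (t : ℝ) ∈ Set.Ioc (1/2:ℝ) 1 := ⟨h, t.2.2⟩
    have hm : (2 * (t:ℝ) - 1) ∈ Set.Icc (0:ℝ) 1 := by constructor <;> linarith [ht.1, ht.2]
    have hle : 1 / 2 ≤ f t := by
      rw [hf2 _ ht]; linarith [(ψ ⟨2 * (t:ℝ) - 1, hm⟩).2.1]
    rw [Path.extend_trans_of_half_le _ _ hle, hf2 _ ht, Path.extend_apply _ hm, reparam_apply,
      mul_div_cancel₀ _ (two_ne_zero), add_sub_cancel_left, Path.extend_extends']

theorem trans_assoc_reparam {x y z w : X} (γ₁ : Path x y) (γ₂ : Path y z) (γ₃ : Path z w) :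
    ∃ χ : I ≃o I, (γ₁.trans γ₂).trans γ₃ = reparam (γ₁.trans (γ₂.trans γ₃)) χ := by
  let f : ℝ → ℝ := fun t ↦ if t ≤ 1 / 4 then 2 * t else if t ≤ 1 / 2 then t + 1 / 4
    else (t + 1) / 2
  have hcont : Continuous f := by
    refine Continuous.if_le (by fun_prop) (Continuous.if_le (by fun_prop) (by fun_prop)
      (by fun_prop) (by fun_prop) ?_) (by fun_prop) (by fun_prop) ?_
    · intro t ht
      rw [ht]; norm_num
    · intro t ht
      rw [ht]; norm_num
  have hmono : StrictMonoOn f (Set.Icc 0 1) := by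
    intro s _ t _ hst
    simp only [f]
    split_ifs <;> linarith
  refine ⟨autOfReal f hcont hmono (by norm_num [f]) (by norm_num [f]), ?_⟩
  ext t
  have e : ∀ (r : Path x w) (s : I), r s = r.extend s := fun r s ↦ by simp
  rw [reparam_apply, e, e, autOfReal_apply]
  rcases le_or_gt (t : ℝ) (1 / 2) with h | h
  · rw [Path.extend_trans_of_le_half _ _ h]
    rcases le_or_gt (t : ℝ) (1 / 4) with h' | h'
    · have hf : f t = 2 * t := by simp only [f, if_pos h']
      rw [hf, Path.extend_trans_of_le_half _ _ (by linarith),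
        Path.extend_trans_of_le_half _ _ (by linarith)]
    · have hf : f t = t + 1 / 4 := by simp only [f, if_neg (not_le.2 h'), if_pos h]
      rw [hf, Path.extend_trans_of_half_le _ _ (by linarith),
        Path.extend_trans_of_half_le _ _ (by linarith),
        Path.extend_trans_of_le_half _ _ (by linarith)]
      congr 1; ring
  · have h' : ¬ ((t : ℝ) ≤ 1 / 4) := by intro h'; linarith
    have hf : f t = (t + 1) / 2 := by simp only [f, if_neg h', if_neg (not_le.2 h)]
    rw [hf, Path.extend_trans_of_half_le _ _ h.le, Path.extend_trans_of_half_le _ _ (by linarith),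
      Path.extend_trans_of_half_le _ _ (by linarith)]
    congr 1; ring

end Paths

/-! ## The box category and precubical sets -/

/-- The coface map `δ_i^α : {0,1}^n → {0,1}^(n+1)`, which inserts `α` at the place `i`. -/
def coface {n : ℕ} (i : Fin (n + 1)) (α : Bool) (ε : Fin n → Bool) : Fin (n + 1) → Bool :=
  Fin.insertNth (α := fun _ ↦ Bool) i α ε

/-- The maps `{0,1}^m → {0,1}^n` generated under composition by the identities and the coface
maps. -/
inductive IsBoxMap : ∀ {m n : ℕ}, ((Fin m → Bool) → (Fin n → Bool)) → Prop
  | id (n : ℕ) : IsBoxMap (fun ε : Fin n → Bool ↦ ε)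
  | coface {n : ℕ} (i : Fin (n + 1)) (α : Bool) : IsBoxMap (coface i α)
  | comp {l m n : ℕ} {f : (Fin l → Bool) → (Fin m → Bool)} {g : (Fin m → Bool) → (Fin n → Bool)} :
      IsBoxMap f → IsBoxMap g → IsBoxMap (fun ε ↦ g (f ε))

/-- The objects `[n] = {0,1}^n` of the box category. -/
structure Box : Type where
  /-- The dimension `n` of `[n]`. -/
  dim : ℕ

/-- The box category: the subcategory of sets generated by the coface maps. -/
instance : SmallCategory Box where
  Hom a b := {f : (Fin a.dim → Bool) → (Fin b.dim → Bool) // IsBoxMap f}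
  id a := ⟨fun ε ↦ ε, IsBoxMap.id a.dim⟩
  comp f g := ⟨fun ε ↦ g.1 (f.1 ε), IsBoxMap.comp f.2 g.2⟩

/-- Precubical sets: presheaves of sets on the box category. -/
abbrev PrecubicalSet := Boxᵒᵖ ⥤ Type u

/-- The set `K_n` of `n`-cubes. -/
abbrev PrecubicalSet.cubes (K : PrecubicalSet.{u}) (n : ℕ) : Type u := K.obj (Opposite.op ⟨n⟩)

theorem IsBoxMap.coordinate {m n : ℕ} {f : (Fin m → Bool) → (Fin n → Bool)} (hf : IsBoxMap f) :
    ∀ i, (∃ b, ∀ ε, f ε i = b) ∨ ∃ j, ∀ ε, f ε i = ε j := by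
  induction hf with
  | id n => exact fun i ↦ Or.inr ⟨i, fun _ ↦ rfl⟩
  | coface k α =>
    intro i
    refine Fin.succAboveCases k ?_ (fun j ↦ ?_) i
    · exact Or.inl ⟨α, fun ε ↦ by simp [DirectedSpace.coface]⟩
    · exact Or.inr ⟨j, fun ε ↦ by simp [DirectedSpace.coface]⟩
  | comp _ _ ihf ihg =>
    intro i
    rcases ihg i with ⟨b, hb⟩ | ⟨j, hj⟩
    · exact Or.inl ⟨b, fun ε ↦ hb _⟩
    · rcases ihf j with ⟨b, hb⟩ | ⟨k, hk⟩
      · exact Or.inl ⟨b, fun ε ↦ (hj _).trans (hb ε)⟩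
      · exact Or.inr ⟨k, fun ε ↦ (hj _).trans (hk ε)⟩

theorem IsBoxMap.exists_coordinate {m n : ℕ} {f : (Fin m → Bool) → (Fin n → Bool)}
    (hf : IsBoxMap f) : ∀ j, ∃ i, ∀ ε, f ε i = ε j := by
  induction hf with
  | id n => exact fun j ↦ ⟨j, fun _ ↦ rfl⟩
  | coface k α => exact fun j ↦ ⟨k.succAbove j, fun ε ↦ by simp [DirectedSpace.coface]⟩
  | comp _ _ ihf ihg =>
    intro j
    obtain ⟨i, hi⟩ := ihf j
    obtain ⟨k, hk⟩ := ihg i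
    exact ⟨k, fun ε ↦ (hk _).trans (hi ε)⟩

/-- The extension to the topological cubes `[0,1]^m → [0,1]^n` of a map `{0,1}^m → {0,1}^n` of the
box category. Every coordinate of such a map is either constant or a coordinate of the source, and
the lattice polynomial below is this constant or this coordinate: see `cubeMap_coface`,
`cubeMap_id` and `cubeMap_comp`. -/
def cubeMap {m n : ℕ} (f : (Fin m → Bool) → (Fin n → Bool)) (x : Fin m → I) (i : Fin n) : I :=
  (Finset.univ.filter (fun ε ↦ f ε i = true)).sup
    (fun ε ↦ (Finset.univ.filter (fun j ↦ ε j = true)).inf x)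

theorem cubeMap_of_const {m n : ℕ} {f : (Fin m → Bool) → (Fin n → Bool)} {i : Fin n} {b : Bool}
    (h : ∀ ε, f ε i = b) (x : Fin m → I) : cubeMap f x i = if b then 1 else 0 := by
  cases b with
  | false => simp only [cubeMap, h]; simp; rfl
  | true =>
    simp only [cubeMap, h]
    refine top_le_iff.1 ?_
    refine le_trans ?_ (Finset.le_sup (b := fun _ ↦ false) (by simp))
    simp

theorem cubeMap_of_proj {m n : ℕ} {f : (Fin m → Bool) → (Fin n → Bool)} {i : Fin n} {j : Fin m}
    (h : ∀ ε, f ε i = ε j) (x : Fin m → I) : cubeMap f x i = x j := by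
  simp only [cubeMap, h]
  refine le_antisymm (Finset.sup_le fun ε hε ↦ Finset.inf_le (by simpa using hε)) ?_
  refine le_trans ?_ (Finset.le_sup (b := fun k ↦ decide (k = j)) (by simp))
  simp

theorem cubeMap_coface {n : ℕ} (i : Fin (n + 1)) (α : Bool) (x : Fin n → I) :
    cubeMap (coface i α) x = Fin.insertNth (α := fun _ ↦ I) i (if α then 1 else 0) x := by
  funext k
  refine Fin.succAboveCases i ?_ (fun j ↦ ?_) k
  · rw [cubeMap_of_const (b := α) (fun ε ↦ by simp [coface])]; simp
  · rw [cubeMap_of_proj (j := j) (fun ε ↦ by simp [coface])]; simp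

theorem cubeMap_id {n : ℕ} (x : Fin n → I) : cubeMap (fun ε : Fin n → Bool ↦ ε) x = x :=
  funext fun i ↦ cubeMap_of_proj (j := i) (fun _ ↦ rfl) x

theorem cubeMap_comp {l m n : ℕ} (f : (Fin l → Bool) → (Fin m → Bool))
    {g : (Fin m → Bool) → (Fin n → Bool)} (hg : IsBoxMap g) (x : Fin l → I) :
    cubeMap (fun ε ↦ g (f ε)) x = cubeMap g (cubeMap f x) := by
  funext i
  rcases hg.coordinate i with ⟨b, hb⟩ | ⟨j, hj⟩
  · rw [cubeMap_of_const hb, cubeMap_of_const (fun ε ↦ hb _)]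
  · rw [cubeMap_of_proj hj]
    simp only [cubeMap, hj]

theorem IsBoxMap.continuous_cubeMap {m n : ℕ} {f : (Fin m → Bool) → (Fin n → Bool)}
    (hf : IsBoxMap f) : Continuous (cubeMap f) := by
  refine continuous_pi fun i ↦ ?_
  rcases hf.coordinate i with ⟨b, hb⟩ | ⟨j, hj⟩
  · simp only [cubeMap_of_const hb]; fun_prop
  · simp only [cubeMap_of_proj hj]; fun_prop

theorem IsBoxMap.monotone_cubeMap {m n : ℕ} {f : (Fin m → Bool) → (Fin n → Bool)}
    (hf : IsBoxMap f) : Monotone (cubeMap f) := by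
  intro x y hxy i
  rcases hf.coordinate i with ⟨b, hb⟩ | ⟨j, hj⟩
  · simp only [cubeMap_of_const hb]; rfl
  · simp only [cubeMap_of_proj hj]; exact hxy j

theorem IsBoxMap.injective_cubeMap {m n : ℕ} {f : (Fin m → Bool) → (Fin n → Bool)}
    (hf : IsBoxMap f) : Function.Injective (cubeMap f) := by
  intro x y hxy
  funext j
  obtain ⟨i, hi⟩ := hf.exists_coordinate j
  rw [← cubeMap_of_proj hi x, hxy, cubeMap_of_proj hi y]

/-- The vertices `{0,1}^n` of the topological cube `[0,1]^n`. -/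
def IsVertex {n : ℕ} (x : Fin n → I) : Prop := ∀ i, x i = 0 ∨ x i = 1

theorem IsBoxMap.isVertex_cubeMap {m n : ℕ} {f : (Fin m → Bool) → (Fin n → Bool)}
    (hf : IsBoxMap f) {x : Fin m → I} (hx : IsVertex x) : IsVertex (cubeMap f x) := by
  intro i
  rcases hf.coordinate i with ⟨b, hb⟩ | ⟨j, hj⟩
  · rw [cubeMap_of_const hb]; cases b <;> simp
  · rw [cubeMap_of_proj hj]; exact hx j

/-! ## Multipointed `d`-spaces -/

/-- A multipointed `d`-space: a `Δ`-generated space, a subset of states, and a set of continuous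
paths `[0,1] → |X|` between states, called the execution paths, which is closed under
reparametrization by nondecreasing homeomorphisms of `[0,1]` and under normalized composition
(`Path.trans`). -/
structure MdTop : Type (u + 1) where
  /-- The underlying space. -/
  carrier : Type u
  [top : TopologicalSpace carrier]
  [deltaGenerated : DeltaGeneratedSpace carrier]
  /-- The set of states. -/
  states : Set carrier
  /-- The execution paths. -/
  IsExec : ∀ {x y : carrier}, Path x y → Prop
  source_mem : ∀ {x y : carrier} {γ : Path x y}, IsExec γ → x ∈ states
  target_mem : ∀ {x y : carrier} {γ : Path x y}, IsExec γ → y ∈ states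
  reparam_mem : ∀ {x y : carrier} {γ : Path x y} (φ : I ≃o I), IsExec γ → IsExec (reparam γ φ)
  trans_mem : ∀ {x y z : carrier} {γ₁ : Path x y} {γ₂ : Path y z},
    IsExec γ₁ → IsExec γ₂ → IsExec (γ₁.trans γ₂)

namespace MdTop

attribute [instance] top deltaGenerated

/-- A map of multipointed `d`-spaces: a continuous map that takes states to states and execution
paths to execution paths. -/
@[ext]
structure Hom (X Y : MdTop.{u}) where
  /-- The underlying continuous map. -/
  map : C(X.carrier, Y.carrier)
  map_states : ∀ x ∈ X.states, map x ∈ Y.states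
  map_exec : ∀ {x y : X.carrier} {γ : Path x y}, X.IsExec γ → Y.IsExec (γ.map map.continuous)

instance : Category MdTop.{u} where
  Hom := Hom
  id X := ⟨ContinuousMap.id _, fun _ h ↦ h, fun h ↦ h⟩
  comp f g := ⟨g.map.comp f.map, fun x h ↦ g.map_states _ (f.map_states x h),
    fun h ↦ g.map_exec (f.map_exec h)⟩

@[simp]
theorem id_map (X : MdTop.{u}) (x : X.carrier) : Hom.map (𝟙 X) x = x := rfl

@[simp]
theorem comp_map {X Y Z : MdTop.{u}} (f : X ⟶ Y) (g : Y ⟶ Z) (x : X.carrier) :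
    Hom.map (f ≫ g) x = g.map (f.map x) := rfl

theorem hom_ext {X Y : MdTop.{u}} {f g : X ⟶ Y} (h : ∀ x, f.map x = g.map x) : f = g :=
  Hom.ext (ContinuousMap.ext h)

theorem IsExec.congr {X : MdTop.{u}} {x y x' y' : X.carrier} {γ : Path x y} {γ' : Path x' y'}
    (h : X.IsExec γ) (e : ∀ t, γ' t = γ t) : X.IsExec γ' := by
  have hx : x' = x := by rw [← γ'.source, e, γ.source]
  have hy : y' = y := by rw [← γ'.target, e, γ.target]
  subst hx hy
  rwa [show γ' = γ from Path.ext (funext e)]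

/-- The underlying space functor. -/
def toTop : MdTop.{u} ⥤ TopCat.{u} where
  obj X := TopCat.of X.carrier
  map f := TopCat.ofHom f.map

/-! ### Colimits of multipointed `d`-spaces -/

section Colimits

variable {J : Type u} [Category.{0} J] (F : J ⥤ MdTop.{u})

/-- The execution paths of the colimit: the smallest set of paths that contains the images of the
execution paths and is closed under reparametrization and normalized composition. -/
inductive ColimitExec (c : Cocone (F ⋙ toTop)) : ∀ {x y : c.pt}, Path x y → Prop
  | of (j : J) {x y : (F.obj j).carrier} (γ : Path x y) (h : (F.obj j).IsExec γ) :
      ColimitExec c (γ.map (c.ι.app j).hom.continuous)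
  | reparam {x y : c.pt} (γ : Path x y) (φ : I ≃o I) :
      ColimitExec c γ → ColimitExec c (reparam γ φ)
  | trans {x y z : c.pt} (γ₁ : Path x y) (γ₂ : Path y z) :
      ColimitExec c γ₁ → ColimitExec c γ₂ → ColimitExec c (γ₁.trans γ₂)

/-- The colimit: the colimit of the underlying spaces, the images of the states, and the final set
of execution paths. -/
def colimitPt {c : Cocone (F ⋙ toTop)} (hc : IsColimit c) : MdTop.{u} where
  carrier := c.pt
  deltaGenerated := by
    have h := TopCat.coinduced_of_isColimit c hc
    rw [h]
    exact IsGeneratedBy.iSup fun j ↦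
      IsGeneratedBy.coinduced (tY := (F.obj j).top) (X := fun n : ℕ ↦ Fin n → ℝ) _
  states := {x | ∃ (j : J) (s : (F.obj j).carrier), s ∈ (F.obj j).states ∧ c.ι.app j s = x}
  IsExec := ColimitExec F c
  source_mem h := by
    induction h with
    | of j γ h => exact ⟨j, _, (F.obj j).source_mem h, rfl⟩
    | reparam γ φ _ ih => exact ih
    | trans γ₁ γ₂ _ _ ih₁ ih₂ => exact ih₁
  target_mem h := by
    induction h with
    | of j γ h => exact ⟨j, _, (F.obj j).target_mem h, rfl⟩
    | reparam γ φ _ ih => exact ih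
    | trans γ₁ γ₂ _ _ ih₁ ih₂ => exact ih₂
  reparam_mem φ h := ColimitExec.reparam _ φ h
  trans_mem h₁ h₂ := ColimitExec.trans _ _ h₁ h₂

/-- The colimit cocone. -/
def colimitCocone {c : Cocone (F ⋙ toTop)} (hc : IsColimit c) : Cocone F where
  pt := colimitPt F hc
  ι :=
    { app j :=
        { map := (c.ι.app j).hom
          map_states := fun x hx ↦ ⟨j, x, hx, rfl⟩
          map_exec := fun h ↦ ColimitExec.of j _ h }
      naturality j k f := by
        refine hom_ext fun x ↦ ?_
        exact ConcreteCategory.congr_hom (c.w f) x }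

/-- The colimit cocone is a colimit. -/
def colimitCoconeIsColimit {c : Cocone (F ⋙ toTop)} (hc : IsColimit c) :
    IsColimit (colimitCocone F hc) where
  desc s :=
    { map := (hc.desc (toTop.mapCocone s)).hom
      map_states := by
        rintro _ ⟨j, x, hx, rfl⟩
        have := ConcreteCategory.congr_hom (hc.fac (toTop.mapCocone s) j) x
        exact (congrArg (· ∈ s.pt.states) this).mpr ((s.ι.app j).map_states x hx)
      map_exec := by
        intro x y γ h
        change ColimitExec F c γ at h
        induction h with
        | of j γ h =>
          refine IsExec.congr ((s.ι.app j).map_exec h) fun t ↦ ?_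
          exact ConcreteCategory.congr_hom (hc.fac (toTop.mapCocone s) j) (γ t)
        | reparam γ φ _ ih => exact s.pt.reparam_mem φ ih
        | trans γ₁ γ₂ _ _ ih₁ ih₂ =>
          refine IsExec.congr (s.pt.trans_mem ih₁ ih₂) fun t ↦ ?_
          exact DFunLike.congr_fun (Path.map_trans γ₁ γ₂ (f := (hc.desc (toTop.mapCocone s)).hom)
            (ContinuousMap.continuous _)) t }
  fac s j := hom_ext fun x ↦
    ConcreteCategory.congr_hom (hc.fac (toTop.mapCocone s) j) x
  uniq s m h := by
    refine hom_ext fun x ↦ ?_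
    have := hc.uniq (toTop.mapCocone s) (toTop.map m) (fun j ↦ by
      have := congrArg toTop.map (h j)
      exact this)
    exact ConcreteCategory.congr_hom this x

instance : HasColimitsOfSize.{0, u} MdTop.{u} where
  has_colimits_of_shape _ _ :=
    { has_colimit F := ⟨⟨⟨_, colimitCoconeIsColimit F (colimit.isColimit (F ⋙ toTop))⟩⟩⟩ }

end Colimits

end MdTop

/-! ## The tame regular realization -/

theorem IsRegular.reparam {X : Type*} [TopologicalSpace X] [T1Space X] {x y : X} {γ : Path x y}
    (h : IsRegular γ) (φ : I ≃o I) : IsRegular (reparam γ φ) := by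
  rw [isRegular_iff γ.continuous] at h
  rw [isRegular_iff (Path.continuous _)]
  intro a b hab hc
  refine h (φ a) (φ b) (φ.strictMono hab) fun s hs t ht ↦ ?_
  have := hc (φ.symm s) ⟨(φ.le_symm_apply).2 hs.1, (φ.symm_apply_le).2 hs.2⟩
    (φ.symm t) ⟨(φ.le_symm_apply).2 ht.1, (φ.symm_apply_le).2 ht.2⟩
  simpa using this

theorem IsRegular.trans {X : Type*} [TopologicalSpace X] [T1Space X] {x y z : X} {γ₁ : Path x y}
    {γ₂ : Path y z} (h₁ : IsRegular γ₁) (h₂ : IsRegular γ₂) : IsRegular (γ₁.trans γ₂) := by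
  rw [isRegular_iff (Path.continuous _)] at h₁ h₂ ⊢
  intro a b hab hc
  have hab' : (a : ℝ) < b := hab
  have e : ∀ s : ℝ, s ∈ Set.Icc (a : ℝ) b → ∀ t : ℝ, t ∈ Set.Icc (a : ℝ) b →
      (γ₁.trans γ₂).extend s = (γ₁.trans γ₂).extend t := by
    intro s hs t ht
    have hs' : s ∈ I := ⟨a.2.1.trans hs.1, hs.2.trans b.2.2⟩
    have ht' : t ∈ I := ⟨a.2.1.trans ht.1, ht.2.trans b.2.2⟩
    rw [Path.extend_apply _ hs', Path.extend_apply _ ht']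
    exact hc ⟨s, hs'⟩ hs ⟨t, ht'⟩ ht
  rcases lt_or_ge (a : ℝ) (1 / 2) with h | h
  · let m : ℝ := min b (1 / 2)
    have hm : m ≤ 1 / 2 := min_le_right _ _
    have hmb : m ≤ b := min_le_left _ _
    have ham : (a : ℝ) < m := lt_min hab' h
    have ha0 : (0 : ℝ) ≤ a := a.2.1
    refine h₁ ⟨2 * a, by constructor <;> linarith⟩ ⟨2 * m, by constructor <;> linarith⟩
      (show 2 * (a : ℝ) < 2 * m by linarith) fun s hs t ht ↦ ?_
    have hs1 : 2 * (a : ℝ) ≤ s := hs.1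
    have hs2 : (s : ℝ) ≤ 2 * m := hs.2
    have ht1 : 2 * (a : ℝ) ≤ t := ht.1
    have ht2 : (t : ℝ) ≤ 2 * m := ht.2
    have := e (s / 2) ⟨by linarith, by linarith⟩ (t / 2) ⟨by linarith, by linarith⟩
    rw [Path.extend_trans_of_le_half _ _ (by linarith),
      Path.extend_trans_of_le_half _ _ (by linarith), mul_div_cancel₀ _ two_ne_zero,
      mul_div_cancel₀ _ two_ne_zero, Path.extend_extends', Path.extend_extends'] at this
    exact this
  · have hb1 : (b : ℝ) ≤ 1 := b.2.2
    refine h₂ ⟨2 * a - 1, by constructor <;> linarith⟩ ⟨2 * b - 1, by constructor <;> linarith⟩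
      (show 2 * (a : ℝ) - 1 < 2 * b - 1 by linarith) fun s hs t ht ↦ ?_
    have hs1 : 2 * (a : ℝ) - 1 ≤ s := hs.1
    have hs2 : (s : ℝ) ≤ 2 * b - 1 := hs.2
    have ht1 : 2 * (a : ℝ) - 1 ≤ t := ht.1
    have ht2 : (t : ℝ) ≤ 2 * b - 1 := ht.2
    have := e ((s + 1) / 2) ⟨by linarith, by linarith⟩ ((t + 1) / 2) ⟨by linarith, by linarith⟩
    rw [Path.extend_trans_of_half_le _ _ (by linarith),
      Path.extend_trans_of_half_le _ _ (by linarith), mul_div_cancel₀ _ two_ne_zero,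
      mul_div_cancel₀ _ two_ne_zero, add_sub_cancel_right, add_sub_cancel_right,
      Path.extend_extends', Path.extend_extends'] at this
    exact this

theorem IsRegular.map {X Y : Type*} [TopologicalSpace X] [TopologicalSpace Y] [T1Space X]
    [T1Space Y] {x y : X} {γ : Path x y} (h : IsRegular γ) {f : X → Y} (hf : Continuous f)
    (hi : Function.Injective f) : IsRegular (γ.map hf) := by
  rw [isRegular_iff (Path.continuous _)] at h ⊢
  exact fun a b hab hc ↦ h a b hab fun s hs t ht ↦ hi (hc s hs t ht)

instance t1Space_cube (n : ℕ) : T1Space (ULift.{u} (Fin n → I)) :=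
  Homeomorph.ulift.isEmbedding.t1Space

/-- A `d`-path of the topological cube `[0,1]^n`: nondecreasing with respect to each axis. -/
def IsDPath {n : ℕ} (γ : I → ULift.{u} (Fin n → I)) : Prop := Monotone fun t ↦ (γ t).down

theorem IsDPath.trans {n : ℕ} {x y z : ULift.{u} (Fin n → I)} {γ₁ : Path x y} {γ₂ : Path y z}
    (h₁ : IsDPath γ₁) (h₂ : IsDPath γ₂) : IsDPath (γ₁.trans γ₂) := by
  have e₁ : ∀ t : ℝ, (γ₁.extend t).down ≤ y.down := by
    intro t
    have := h₁ (show Set.projIcc 0 1 zero_le_one t ≤ (1 : I) from unitInterval.le_one _)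
    simp only [Path.target] at this
    exact this
  have e₂ : ∀ t : ℝ, y.down ≤ (γ₂.extend t).down := by
    intro t
    have := h₂ (show (0 : I) ≤ Set.projIcc 0 1 zero_le_one t from unitInterval.nonneg _)
    simp only [Path.source] at this
    exact this
  have m₁ : ∀ s t : ℝ, s ≤ t → (γ₁.extend s).down ≤ (γ₁.extend t).down :=
    fun s t h ↦ h₁ (Set.monotone_projIcc zero_le_one h)
  have m₂ : ∀ s t : ℝ, s ≤ t → (γ₂.extend s).down ≤ (γ₂.extend t).down :=
    fun s t h ↦ h₂ (Set.monotone_projIcc zero_le_one h)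
  intro s t hst
  have hst' : (s : ℝ) ≤ t := hst
  have e : ∀ s : I, (γ₁.trans γ₂) s = (γ₁.trans γ₂).extend s := fun s ↦ by simp
  change ((γ₁.trans γ₂) s).down ≤ ((γ₁.trans γ₂) t).down
  rw [e s, e t]
  rcases le_or_gt (t : ℝ) (1 / 2) with h | h
  · rw [Path.extend_trans_of_le_half _ _ h, Path.extend_trans_of_le_half _ _ (hst'.trans h)]
    exact m₁ _ _ (by linarith)
  · rw [Path.extend_trans_of_half_le _ _ h.le]
    rcases le_or_gt (s : ℝ) (1 / 2) with h' | h'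
    · rw [Path.extend_trans_of_le_half _ _ h']
      exact (e₁ _).trans (e₂ _)
    · rw [Path.extend_trans_of_half_le _ _ h'.le]
      exact m₂ _ _ (by linarith)

/-- The regular `n`-cube: the states are the vertices of `[0,1]^n`, and the execution paths from
`a` to `b` are the regular `d`-paths from `a` to `b` if `a < b`; there are none otherwise. -/
def regularCube (n : ℕ) : MdTop.{u} where
  carrier := ULift.{u} (Fin n → I)
  states := {x | IsVertex x.down}
  IsExec {x y} γ := IsVertex x.down ∧ IsVertex y.down ∧ x.down < y.down ∧ IsDPath γ ∧ IsRegular γ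
  source_mem h := h.1
  target_mem h := h.2.1
  reparam_mem φ h := ⟨h.1, h.2.1, h.2.2.1, h.2.2.2.1.comp φ.monotone, h.2.2.2.2.reparam φ⟩
  trans_mem h₁ h₂ := ⟨h₁.1, h₂.2.1, h₁.2.2.1.trans h₂.2.2.1, h₁.2.2.2.1.trans h₂.2.2.2.1,
    h₁.2.2.2.2.trans h₂.2.2.2.2⟩

theorem IsBoxMap.continuous_up {m n : ℕ} {f : (Fin m → Bool) → (Fin n → Bool)}
    (hf : IsBoxMap f) :
    Continuous fun x : ULift.{u} (Fin m → I) ↦ (ULift.up (cubeMap f x.down) : ULift.{u} _) :=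
  continuous_uliftUp.comp (hf.continuous_cubeMap.comp continuous_uliftDown)

theorem IsBoxMap.isRegular_map {m n : ℕ} {f : (Fin m → Bool) → (Fin n → Bool)}
    (hf : IsBoxMap f) {x y : ULift.{u} (Fin m → I)} (γ : Path x y) (h : IsRegular γ) :
    IsRegular (γ.map hf.continuous_up) :=
  h.map _ fun _ _ e ↦ ULift.down_injective (hf.injective_cubeMap (congrArg ULift.down e))

/-- The cocubical multipointed `d`-space of the regular cubes. -/
def regularCubes : Box ⥤ MdTop.{u} where
  obj b := regularCube b.dim
  map f :=
    { map := ⟨fun x ↦ ULift.up (cubeMap f.1 x.down),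
        f.2.continuous_up⟩
      map_states := fun _ hx ↦ f.2.isVertex_cubeMap hx
      map_exec := fun {_ _ γ} h ↦
        ⟨f.2.isVertex_cubeMap h.1, f.2.isVertex_cubeMap h.2.1,
          (f.2.monotone_cubeMap.strictMono_of_injective f.2.injective_cubeMap) h.2.2.1,
          f.2.monotone_cubeMap.comp h.2.2.2.1,
          f.2.isRegular_map γ h.2.2.2.2⟩ }
  map_id _ := MdTop.hom_ext fun x ↦ congrArg ULift.up (cubeMap_id x.down)
  map_comp f g := MdTop.hom_ext fun x ↦ congrArg ULift.up (cubeMap_comp f.1 g.2 x.down)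

namespace PrecubicalSet

/-- The diagram of the regular cubes over the category of the cubes of `K`. -/
abbrev diagram (K : PrecubicalSet.{u}) : K.Elementsᵒᵖ ⥤ MdTop.{u} :=
  (CategoryOfElements.π K).leftOp ⋙ regularCubes

/-- The canonical map from the regular `n`-cube to the realization given by an `n`-cube of `K`. -/
def cell (K : PrecubicalSet.{u}) {b : Box} (c : K.obj (Opposite.op b)) :
    regularCubes.obj b ⟶ colimit K.diagram :=
  colimit.ι K.diagram (Opposite.op ⟨Opposite.op b, c⟩)

theorem cell_face (K : PrecubicalSet.{u}) {a b : Box} (f : a ⟶ b) (c : K.obj (Opposite.op b)) :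
    regularCubes.map f ≫ K.cell c = K.cell (K.map f.op c) :=
  colimit.w K.diagram
    (Quiver.Hom.op (CategoryOfElements.homMk (F := K) ⟨Opposite.op b, c⟩
      ⟨Opposite.op a, K.map f.op c⟩ f.op rfl))

theorem realization_hom_ext (K : PrecubicalSet.{u}) {Z : MdTop.{u}} {f g : colimit K.diagram ⟶ Z}
    (h : ∀ (b : Box) (c : K.obj (Opposite.op b)), K.cell c ≫ f = K.cell c ≫ g) : f = g :=
  colimit.hom_ext fun j ↦ h j.unop.1.unop j.unop.2

/-- The map induced between the realizations. -/
def realizationMap {K L : PrecubicalSet.{u}} (f : K ⟶ L) :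
    colimit K.diagram ⟶ colimit L.diagram :=
  colimit.desc K.diagram
    { pt := colimit L.diagram
      ι :=
        { app j := L.cell (b := j.unop.1.unop) (f.app _ j.unop.2)
          naturality j k g := by
            have h := L.cell_face g.unop.1.unop (f.app _ k.unop.2)
            have e : L.map g.unop.1 (f.app _ k.unop.2) = f.app _ j.unop.2 := by
              rw [← NatTrans.naturality_apply, g.unop.2]
            refine h.trans ?_
            refine Eq.trans ?_ (Category.comp_id _).symm
            exact congrArg (L.cell (b := j.unop.1.unop)) e } }

@[simp]
theorem cell_realizationMap {K L : PrecubicalSet.{u}} (f : K ⟶ L) {b : Box}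
    (c : K.obj (Opposite.op b)) :
    K.cell c ≫ realizationMap f = L.cell (f.app _ c) :=
  colimit.ι_desc _ _

/-- The tame regular realization `|K|^t_reg`: the colimit over the cubes of `K` of the regular
cubes. -/
def tameRegularRealization : PrecubicalSet.{u} ⥤ MdTop.{u} where
  obj K := colimit K.diagram
  map f := realizationMap f
  map_id K := K.realization_hom_ext fun b c ↦ by simp
  map_comp f g := realization_hom_ext _ fun b c ↦ by
    rw [← Category.assoc, cell_realizationMap, cell_realizationMap, cell_realizationMap]
    rfl

end PrecubicalSet

/-! ## Flows -/

/-- A flow: a small semicategory enriched over `Δ`-generated spaces. It has a set of states, a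
`Δ`-generated space of execution paths for each pair of states, and an associative composition law
that is continuous on the product taken in the category of `Δ`-generated spaces. -/
structure Flow : Type (u + 1) where
  /-- The states. -/
  states : Type u
  /-- The space of execution paths between two states. -/
  path : states → states → Type u
  [top : ∀ α β, TopologicalSpace (path α β)]
  [deltaGenerated : ∀ α β, DeltaGeneratedSpace (path α β)]
  /-- The composition of execution paths. -/
  comp : ∀ {α β γ : states}, path α β → path β γ → path α γ
  comp_continuous : ∀ α β γ : states,
    DeltaContinuous fun p : path α β × path β γ ↦ comp p.1 p.2
  comp_assoc : ∀ {α β γ δ : states} (x : path α β) (y : path β γ) (z : path γ δ),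
    comp (comp x y) z = comp x (comp y z)

namespace Flow

attribute [instance] top deltaGenerated

/-- A map of flows: a map on states and continuous maps on path spaces that respect the
composition. -/
@[ext]
structure Hom (X Y : Flow.{u}) where
  /-- The map on states. -/
  onStates : X.states → Y.states
  /-- The maps on path spaces. -/
  onPaths : ∀ {α β : X.states}, X.path α β → Y.path (onStates α) (onStates β)
  continuous_onPaths : ∀ α β : X.states, Continuous (onPaths (α := α) (β := β))
  onPaths_comp : ∀ {α β γ : X.states} (x : X.path α β) (y : X.path β γ),
    onPaths (X.comp x y) = Y.comp (onPaths x) (onPaths y)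

instance : Category Flow.{u} where
  Hom := Hom
  id X := ⟨fun α ↦ α, fun x ↦ x, fun _ _ ↦ continuous_id, fun _ _ ↦ rfl⟩
  comp f g := ⟨fun α ↦ g.onStates (f.onStates α), fun x ↦ g.onPaths (f.onPaths x),
    fun _ _ ↦ (g.continuous_onPaths _ _).comp (f.continuous_onPaths _ _),
    fun x y ↦ by rw [f.onPaths_comp, g.onPaths_comp]⟩

end Flow

/-! ## The categorization functor -/

namespace MdTop

/-- The space `P^top_{α,β} X` of execution paths from `α` to `β`, with the `Δ`-kelleyfication of
the relative topology induced by the compact-open topology. (Replacing the compact-open topology by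
its `Δ`-kelleyfication does not change the `Δ`-kelleyfication of the relative topology.) -/
abbrev ExecPath (X : MdTop.{u}) (α β : X.states) : Type u :=
  DeltaGeneratedSpace.of (Y := {γ : Path (α : X.carrier) (β : X.carrier) // X.IsExec γ})

namespace ExecPath

variable {X : MdTop.{u}} {α β γ : X.states}

/-- The underlying path. -/
def path (c : X.ExecPath α β) : Path (α : X.carrier) (β : X.carrier) :=
  (WithGeneratedByTopology.equiv c).1

theorem isExec (c : X.ExecPath α β) : X.IsExec c.path := (WithGeneratedByTopology.equiv c).2

/-- Constructor. -/
def mk (p : Path (α : X.carrier) (β : X.carrier)) (h : X.IsExec p) : X.ExecPath α β :=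
  WithGeneratedByTopology.equiv.symm ⟨p, h⟩

@[ext]
theorem ext {c d : X.ExecPath α β} (h : c.path = d.path) : c = d :=
  WithGeneratedByTopology.equiv.injective (Subtype.ext h)

theorem continuous_path : Continuous (path : X.ExecPath α β → _) :=
  continuous_subtype_val.comp WithGeneratedByTopology.continuous_equiv

theorem deltaContinuous_mk {T : Type*} [TopologicalSpace T]
    {f : T → Path (α : X.carrier) (β : X.carrier)} (hf : Continuous f) (h : ∀ t, X.IsExec (f t)) :
    DeltaContinuous fun t ↦ mk (f t) (h t) :=
  ContinuousGeneratedBy.comp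
    (WithGeneratedByTopology.equivSymmAsContinuousMapGeneratedBy (fun n : ℕ ↦ Fin n → ℝ)
      {γ : Path (α : X.carrier) (β : X.carrier) // X.IsExec γ}).prop
    (hf.subtype_mk h).continuousGeneratedBy

end ExecPath

/-- Two execution paths are identified if one is a reparametrization of the other. -/
def reparamSetoid (X : MdTop.{u}) (α β : X.states) : Setoid (X.ExecPath α β) where
  r c d := ∃ φ : I ≃o I, d.path = reparam c.path φ
  iseqv :=
    { refl c := ⟨OrderIso.refl _, rfl⟩
      symm := by
        rintro c d ⟨φ, h⟩
        refine ⟨φ.symm, ?_⟩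
        rw [h]
        ext t
        simp
      trans := by
        rintro c d e ⟨φ, h⟩ ⟨ψ, h'⟩
        exact ⟨ψ.trans φ, by rw [h', h]; rfl⟩ }

/-- The coequalizer `P_{α,β} X` of the maps `(c, φ) ↦ c` and `(c, φ) ↦ c.φ` from
`P^top_{α,β} X × G(1,1)` to `P^top_{α,β} X`: the quotient space of `P^top_{α,β} X` by
reparametrization. -/
abbrev Trace (X : MdTop.{u}) (α β : X.states) : Type u := Quotient (X.reparamSetoid α β)

/-- The composition of `P_{α,β} X`, induced by the normalized composition. -/
def Trace.comp {X : MdTop.{u}} {α β γ : X.states} : X.Trace α β → X.Trace β γ → X.Trace α γ :=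
  Quotient.map₂ (fun c d ↦ ExecPath.mk (c.path.trans d.path) (X.trans_mem c.isExec d.isExec)) (by
    rintro c c' ⟨φ, hφ⟩ d d' ⟨ψ, hψ⟩
    obtain ⟨χ, hχ⟩ := trans_reparam c.path d.path φ ψ
    refine ⟨χ, ?_⟩
    change c'.path.trans d'.path = _
    rw [hφ, hψ, hχ]
    rfl)

/-- The flow `Cat(X)`. -/
def catObj (X : MdTop.{u}) : Flow.{u} where
  states := X.states
  path := X.Trace
  comp := Trace.comp
  comp_continuous α β γ := by
    refine DeltaContinuous.descend (isQuotientMap_quotient_mk' (s := X.reparamSetoid α β))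
      (isQuotientMap_quotient_mk' (s := X.reparamSetoid β γ)) ?_
    refine ContinuousGeneratedBy.comp (Continuous.continuousGeneratedBy
      (isQuotientMap_quotient_mk' (s := X.reparamSetoid α γ)).continuous)
      (ExecPath.deltaContinuous_mk (f := fun p : X.ExecPath α β × X.ExecPath β γ ↦
        p.1.path.trans p.2.path) ?_ fun p ↦ X.trans_mem p.1.isExec p.2.isExec)
    exact Path.continuous_trans.comp ((ExecPath.continuous_path.comp continuous_fst).prodMk
      (ExecPath.continuous_path.comp continuous_snd))
  comp_assoc x y z := by
    induction x using Quotient.inductionOn with | _ x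
    induction y using Quotient.inductionOn with | _ y
    induction z using Quotient.inductionOn with | _ z
    obtain ⟨χ, hχ⟩ := trans_assoc_reparam x.path y.path z.path
    refine (Quotient.sound (s := X.reparamSetoid _ _) ?_).symm
    exact ⟨χ, hχ⟩

/-- The image of an execution path. -/
def ExecPath.map {X Y : MdTop.{u}} (f : X ⟶ Y) {α β : X.states} (c : X.ExecPath α β) :
    Y.ExecPath ⟨f.map α, f.map_states _ α.2⟩ ⟨f.map β, f.map_states _ β.2⟩ :=
  ExecPath.mk (c.path.map f.map.continuous) (f.map_exec c.isExec)

theorem ExecPath.continuous_map {X Y : MdTop.{u}} (f : X ⟶ Y) (α β : X.states) :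
    Continuous (ExecPath.map f : X.ExecPath α β → _) := by
  refine DeltaContinuous.continuous (ExecPath.deltaContinuous_mk ?_ _)
  rw [Path.continuous_uncurry_iff.symm]
  exact f.map.continuous.comp (continuous_eval.comp
    ((ExecPath.continuous_path.comp continuous_fst).prodMk continuous_snd))

/-- The image of the class of an execution path. -/
def Trace.map {X Y : MdTop.{u}} (f : X ⟶ Y) {α β : X.states} :
    X.Trace α β → Y.Trace ⟨f.map α, f.map_states _ α.2⟩ ⟨f.map β, f.map_states _ β.2⟩ :=
  Quotient.map (ExecPath.map f) (by
    rintro c d ⟨φ, h⟩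
    exact ⟨φ, congrArg (fun p ↦ p.map f.map.continuous) h⟩)

theorem Trace.continuous_map {X Y : MdTop.{u}} (f : X ⟶ Y) (α β : X.states) :
    Continuous (Trace.map f : X.Trace α β → _) := by
  refine (isQuotientMap_quotient_mk' (s := X.reparamSetoid α β)).continuous_iff.2 ?_
  exact (isQuotientMap_quotient_mk' (s := Y.reparamSetoid _ _)).continuous.comp
    (ExecPath.continuous_map f α β)

theorem Trace.map_comp {X Y : MdTop.{u}} (f : X ⟶ Y) {α β γ : X.states} (x : X.Trace α β)
    (y : X.Trace β γ) :
    Trace.map f (Trace.comp x y) = Trace.comp (Trace.map f x) (Trace.map f y) := by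
  induction x using Quotient.inductionOn with | _ x
  induction y using Quotient.inductionOn with | _ y
  exact congrArg (Quotient.mk (Y.reparamSetoid _ _))
    (ExecPath.ext (Path.map_trans x.path y.path f.map.continuous))

/-- The categorization functor `Cat` from multipointed `d`-spaces to flows. -/
def cat : MdTop.{u} ⥤ Flow.{u} where
  obj X := X.catObj
  map {X Y} f :=
    { onStates := fun α : X.states ↦ (⟨f.map α, f.map_states _ α.2⟩ : Y.states)
      onPaths := Trace.map f
      continuous_onPaths := Trace.continuous_map f
      onPaths_comp := Trace.map_comp f }
  map_id X := by
    refine Flow.Hom.ext rfl (heq_of_eq ?_)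
    funext α β x
    induction x using Quotient.inductionOn with | _ x
    rfl
  map_comp f g := by
    refine Flow.Hom.ext rfl (heq_of_eq ?_)
    funext α β x
    induction x using Quotient.inductionOn with | _ x
    rfl

end MdTop

/-! ## The tame concrete realization -/

namespace PrecubicalSet

/-- The geometric realization of `K`: the underlying space of `|K|^t_reg`. -/
abbrev Geom (K : PrecubicalSet.{u}) : Type u := (tameRegularRealization.obj K).carrier

/-- The map `|c|_geom : [0,1]^n → |K|_geom` given by an `n`-cube `c` of `K`. -/
def cube (K : PrecubicalSet.{u}) {n : ℕ} (c : K.cubes n) (x : Fin n → I) : K.Geom :=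
  (K.cell c).map (ULift.up x)

/-- The point of `|K|_geom` given by a vertex of `K`. -/
def vertex (K : PrecubicalSet.{u}) (α : K.cubes 0) : K.Geom := K.cube α Fin.elim0

/-- The continuous map `|K|_geom → |L|_geom` given by a map `K → L`. -/
def geomMap {K L : PrecubicalSet.{u}} (f : K ⟶ L) : C(K.Geom, L.Geom) :=
  (tameRegularRealization.map f).map

theorem geomMap_cube {K L : PrecubicalSet.{u}} (f : K ⟶ L) {n : ℕ} (c : K.cubes n)
    (x : Fin n → I) : geomMap f (K.cube c x) = L.cube (f.app _ c) x :=
  congrArg (fun g ↦ MdTop.Hom.map g (ULift.up x)) (cell_realizationMap f c)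

theorem geomMap_id (K : PrecubicalSet.{u}) (x : K.Geom) : geomMap (𝟙 K) x = x := by
  rw [geomMap, CategoryTheory.Functor.map_id]
  rfl

theorem geomMap_comp {K L M : PrecubicalSet.{u}} (f : K ⟶ L) (g : L ⟶ M) (x : K.Geom) :
    geomMap (f ≫ g) x = geomMap g (geomMap f x) := by
  rw [geomMap, CategoryTheory.Functor.map_comp]
  rfl

/-- The relation `HasL1Length K γ a b s`: the restriction of `γ` to `[a,b]` is a `d`-path of `K`,
that is, a Moore composition of paths of the form `[c;δ] = |c|_geom ∘ δ` where `c` is a cube of `K`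
and `δ` is a continuous path in `[0,1]^n` which is nondecreasing with respect to each axis, and `s`
is its `L₁`-arc length, that is, the sum of the `d₁`-distances between the end points of the
paths `δ`. -/
inductive HasL1Length (K : PrecubicalSet.{u}) (γ : ℝ → K.Geom) : ℝ → ℝ → ℝ → Prop
  | cube {a b : ℝ} (hab : a ≤ b) {n : ℕ} (c : K.cubes n) (δ : ℝ → Fin n → I)
      (continuousOn : ContinuousOn δ (Set.Icc a b)) (monotoneOn : MonotoneOn δ (Set.Icc a b))
      (eq : ∀ t ∈ Set.Icc a b, γ t = K.cube c (δ t)) :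
      HasL1Length K γ a b (∑ i, |(δ b i : ℝ) - (δ a i : ℝ)|)
  | concat {a b c s s' : ℝ} :
      HasL1Length K γ a b s → HasL1Length K γ b c s' → HasL1Length K γ a c (s + s')

theorem HasL1Length.le {K : PrecubicalSet.{u}} {γ : ℝ → K.Geom} {a b s : ℝ}
    (h : HasL1Length K γ a b s) : a ≤ b := by
  induction h with
  | cube hab => exact hab
  | concat _ _ ih ih' => exact ih.trans ih'

theorem HasL1Length.congr {K : PrecubicalSet.{u}} {γ γ' : ℝ → K.Geom} {a b s : ℝ}
    (h : HasL1Length K γ a b s) (d : ℝ) (e : ∀ t ∈ Set.Icc a b, γ' (t + d) = γ t) :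
    HasL1Length K γ' (a + d) (b + d) s := by
  induction h with
  | @cube a b hab n c δ hc hm he =>
    have hmap : Set.MapsTo (fun t : ℝ ↦ t - d) (Set.Icc (a + d) (b + d)) (Set.Icc a b) :=
      fun t ht ↦ ⟨by linarith [ht.1], by linarith [ht.2]⟩
    have := HasL1Length.cube (K := K) (γ := γ') (a := a + d) (b := b + d) (by linarith) c
      (fun t ↦ δ (t - d)) (hc.comp (by fun_prop) hmap)
      (fun s hs t ht hst ↦ hm (hmap hs) (hmap ht) (by linarith)) (fun t ht ↦ by
        rw [← he _ (hmap ht), ← e _ (hmap ht), sub_add_cancel])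
    simpa using this
  | concat h h' ih ih' =>
    exact HasL1Length.concat (ih fun t ht ↦ e t ⟨ht.1, ht.2.trans h'.le⟩)
      (ih' fun t ht ↦ e t ⟨h.le.trans ht.1, ht.2⟩)

theorem HasL1Length.map {K L : PrecubicalSet.{u}} (f : K ⟶ L) {γ : ℝ → K.Geom} {a b s : ℝ}
    (h : HasL1Length K γ a b s) : HasL1Length L (fun t ↦ geomMap f (γ t)) a b s := by
  induction h with
  | cube hab c δ hc hm he =>
    exact HasL1Length.cube hab (f.app _ c) δ hc hm fun t ht ↦ by rw [he t ht, geomMap_cube]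
  | concat _ _ ih ih' => exact HasL1Length.concat ih ih'

/-- The set `R^ℓ_{α,β}(K)` of the (nonconstant) tame regular `d`-paths of `K` of length `ℓ` from `α`
to `β`: the paths `t ↦ p (t / ℓ)` for `p` an execution path of `|K|^t_reg` from `α` to `β`. -/
def tameRegularPaths (K : PrecubicalSet.{u}) (ℓ : ℝ) (α β : K.cubes 0) :
    Set C(Set.Icc (0 : ℝ) ℓ, K.Geom) :=
  {γ | ∃ p : Path (K.vertex α) (K.vertex β), (tameRegularRealization.obj K).IsExec p ∧
    ∀ t, γ t = p.extend (t / ℓ)}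

/-- The extension to `ℝ` of a Moore path of length `ℓ`, constant outside `[0,ℓ]`. -/
def extend {X : Type*} [TopologicalSpace X] {n : ℕ+} (γ : C(Set.Icc (0 : ℝ) n, X)) : ℝ → X :=
  Set.IccExtend (Nat.cast_nonneg (n : ℕ)) γ

/-- The natural paths: the tame regular `d`-paths `γ` of `K` of length `n` from `α` to `β` such that
the `L₁`-arc length between `γ 0` and `γ t` is `t` for all `t ∈ [0,n]`. -/
def naturalPaths (K : PrecubicalSet.{u}) (n : ℕ+) (α β : K.cubes 0) :
    Set C(Set.Icc (0 : ℝ) n, K.Geom) :=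
  {γ | γ ∈ K.tameRegularPaths n α β ∧ ∀ t ∈ Set.Icc (0 : ℝ) n, HasL1Length K (extend γ) 0 t t}

/-- The space `N^n_{α,β}(K)` of natural paths, with the `Δ`-kelleyfication of the relative
topology. -/
abbrev NaturalPath (K : PrecubicalSet.{u}) (n : ℕ+) (α β : K.cubes 0) : Type u :=
  DeltaGeneratedSpace.of (Y := K.naturalPaths n α β)

section Extend

variable {X : Type*} [TopologicalSpace X] {m n : ℕ+}

theorem extend_apply (γ : C(Set.Icc (0 : ℝ) n, X)) (t : Set.Icc (0 : ℝ) n) : extend γ t = γ t :=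
  Set.IccExtend_val _ _ _

theorem continuous_extend (γ : C(Set.Icc (0 : ℝ) n, X)) : Continuous (extend γ) :=
  γ.continuous.Icc_extend'

/-- The Moore composition of two paths of length `m` and `n` such that the second one starts where
the first one stops. -/
def mooreComp (γ₁ : C(Set.Icc (0 : ℝ) m, X)) (γ₂ : C(Set.Icc (0 : ℝ) n, X))
    (h : extend γ₁ m = extend γ₂ 0) : C(Set.Icc (0 : ℝ) (m + n : ℕ+), X) where
  toFun t := if (t : ℝ) ≤ m then extend γ₁ t else extend γ₂ (t - m)
  continuous_toFun := by
    refine Continuous.if_le ((continuous_extend γ₁).comp (by fun_prop))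
      ((continuous_extend γ₂).comp (by fun_prop)) (by fun_prop) (by fun_prop) ?_
    intro t ht
    rw [ht, h, sub_self]

theorem extend_mooreComp (γ₁ : C(Set.Icc (0 : ℝ) m, X)) (γ₂ : C(Set.Icc (0 : ℝ) n, X))
    (h : extend γ₁ m = extend γ₂ 0) (t : ℝ) :
    extend (mooreComp γ₁ γ₂ h) t = if t ≤ m then extend γ₁ t else extend γ₂ (t - m) := by
  have hm : (0 : ℝ) < m := Nat.cast_pos.2 m.pos
  have hn : (0 : ℝ) < n := Nat.cast_pos.2 n.pos
  have hmn : ((m + n : ℕ+) : ℝ) = m + n := by push_cast; rfl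
  rcases lt_or_ge t 0 with h0 | h0
  · rw [if_pos (by linarith), extend, Set.IccExtend_of_le_left _ _ h0.le, extend,
      Set.IccExtend_of_le_left _ _ h0.le]
    change (if (0 : ℝ) ≤ m then extend γ₁ 0 else _) = _
    rw [if_pos hm.le]
    exact extend_apply γ₁ ⟨0, _⟩
  · rcases le_or_gt t (m + n) with h1 | h1
    · exact extend_apply (mooreComp γ₁ γ₂ h) ⟨t, h0, by rw [hmn]; exact h1⟩
    · rw [if_neg (by linarith), extend, Set.IccExtend_of_right_le _ _ (by rw [hmn]; exact h1.le),
        extend, Set.IccExtend_of_right_le _ _ (by linarith)]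
      change (if ((m + n : ℕ+) : ℝ) ≤ m then _ else extend γ₂ (((m + n : ℕ+) : ℝ) - m)) = _
      rw [if_neg (by rw [hmn]; linarith), hmn, add_sub_cancel_left]
      exact extend_apply γ₂ ⟨n, _⟩

end Extend

theorem tameRegularPaths_comp {K : PrecubicalSet.{u}} {m n : ℕ+} {α β γ : K.cubes 0}
    {γ₁ : C(Set.Icc (0 : ℝ) m, K.Geom)} {γ₂ : C(Set.Icc (0 : ℝ) n, K.Geom)}
    (h₁ : γ₁ ∈ K.tameRegularPaths m α β) (h₂ : γ₂ ∈ K.tameRegularPaths n β γ)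
    (h : extend γ₁ m = extend γ₂ 0) :
    mooreComp γ₁ γ₂ h ∈ K.tameRegularPaths (m + n : ℕ+) α γ := by
  obtain ⟨p, hp, ep⟩ := h₁
  obtain ⟨q, hq, eq⟩ := h₂
  have hm : (0 : ℝ) < m := Nat.cast_pos.2 m.pos
  have hn : (0 : ℝ) < n := Nat.cast_pos.2 n.pos
  have hmn : ((m + n : ℕ+) : ℝ) = m + n := by push_cast; rfl
  let f : ℝ → ℝ := fun s ↦ if s * (m + n) ≤ m then s * (m + n) / (2 * m)
    else 1 / 2 + (s * (m + n) - m) / (2 * n)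
  have hcont : Continuous f := by
    refine Continuous.if_le (by fun_prop) (by fun_prop) (by fun_prop) (by fun_prop) ?_
    intro s hs
    rw [hs]
    field_simp
    ring
  have hmono : StrictMonoOn f (Set.Icc 0 1) := by
    intro s _ t _ hst
    have hst' : s * (m + n) < t * ((m : ℝ) + n) := mul_lt_mul_of_pos_right hst (by linarith)
    simp only [f]
    split_ifs with hs ht ht
    · gcongr
    · have e1 : s * (m + n) / (2 * (m : ℝ)) ≤ 1 / 2 := by
        rw [div_le_div_iff₀ (by linarith) two_pos]; linarith
      have e2 : 0 < (t * ((m : ℝ) + n) - m) / (2 * n) := div_pos (by linarith) (by linarith)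
      linarith
    · linarith
    · gcongr
  have h0 : f 0 = 0 := by simp [f]
  have h1 : f 1 = 1 := by
    have : ¬ (1 * ((m : ℝ) + n) ≤ m) := by linarith
    simp only [f, if_neg this]
    field_simp
    ring
  refine ⟨reparam (p.trans q) (autOfReal f hcont hmono h0 h1),
    MdTop.reparam_mem _ _ (MdTop.trans_mem _ hp hq), fun t ↦ ?_⟩
  have ht0 : (0 : ℝ) ≤ t := t.2.1
  have ht1 : (t : ℝ) ≤ m + n := t.2.2.trans hmn.le
  have hs : (t : ℝ) / (m + n : ℕ+) ∈ I :=
    ⟨div_nonneg ht0 (Nat.cast_nonneg _), div_le_one_of_le₀ t.2.2 (Nat.cast_nonneg _)⟩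
  rw [Path.extend_apply _ hs, reparam_apply, ← Path.extend_extends', autOfReal_apply]
  have hsc : (t : ℝ) / (m + n : ℕ+) * (m + n) = t := by
    generalize (t : ℝ) = r
    rw [hmn]
    field_simp
  change (if (t : ℝ) ≤ m then extend γ₁ t else extend γ₂ (t - m)) = _
  simp only [f, hsc]
  split_ifs with htm
  · rw [Path.extend_trans_of_le_half _ _ (by
      rw [div_le_div_iff₀ (by linarith) two_pos]; linarith)]
    rw [show extend γ₁ t = _ from (extend_apply γ₁ ⟨t, ht0, htm⟩).trans (ep _)]
    congr 1
    change (t : ℝ) / m = _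
    field_simp
  · have htm' : (m : ℝ) < t := not_le.1 htm
    rw [Path.extend_trans_of_half_le _ _ (by
      have : 0 ≤ ((t : ℝ) - m) / (2 * n) := div_nonneg (by linarith) (by linarith)
      linarith)]
    rw [show extend γ₂ (t - m) = _ from
      (extend_apply γ₂ ⟨t - m, by linarith, by linarith⟩).trans (eq _)]
    congr 1
    change ((t : ℝ) - m) / n = _
    field_simp
    ring

theorem naturalPaths_comp {K : PrecubicalSet.{u}} {m n : ℕ+} {α β γ : K.cubes 0}
    {γ₁ : C(Set.Icc (0 : ℝ) m, K.Geom)} {γ₂ : C(Set.Icc (0 : ℝ) n, K.Geom)}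
    (h₁ : γ₁ ∈ K.naturalPaths m α β) (h₂ : γ₂ ∈ K.naturalPaths n β γ)
    (h : extend γ₁ m = extend γ₂ 0) :
    mooreComp γ₁ γ₂ h ∈ K.naturalPaths (m + n) α γ := by
  refine ⟨tameRegularPaths_comp h₁.1 h₂.1 h, fun t ht ↦ ?_⟩
  have hm : (0 : ℝ) < m := Nat.cast_pos.2 m.pos
  have hmn : ((m + n : ℕ+) : ℝ) = m + n := by push_cast; rfl
  have key : ∀ t ∈ Set.Icc (0 : ℝ) m, HasL1Length K (extend (mooreComp γ₁ γ₂ h)) 0 t t := by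
    intro t ht
    have := (h₁.2 t ht).congr (γ' := extend (mooreComp γ₁ γ₂ h)) 0 fun s hs ↦ by
      rw [add_zero, extend_mooreComp, if_pos (hs.2.trans ht.2)]
    simpa using this
  rcases le_or_gt t m with htm | htm
  · exact key t ⟨ht.1, htm⟩
  · have h3 := (h₂.2 (t - m) ⟨by linarith, by have := ht.2; rw [hmn] at this; linarith⟩).congr
      (γ' := extend (mooreComp γ₁ γ₂ h)) m fun s hs ↦ by
        rw [extend_mooreComp]
        split_ifs with hle
        · have : s = 0 := le_antisymm (by linarith) hs.1
          rw [this, zero_add, h]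
        · rw [add_sub_cancel_right]
    have h4 := (key m ⟨hm.le, le_rfl⟩).concat (by simpa using h3)
    simpa using h4

theorem naturalPaths_source {K : PrecubicalSet.{u}} {n : ℕ+} {α β : K.cubes 0}
    {γ : C(Set.Icc (0 : ℝ) n, K.Geom)} (h : γ ∈ K.naturalPaths n α β) :
    extend γ 0 = K.vertex α := by
  obtain ⟨p, -, hp⟩ := h.1
  rw [show extend γ 0 = _ from (extend_apply γ ⟨0, le_rfl, Nat.cast_nonneg _⟩).trans (hp _)]
  simp

theorem naturalPaths_target {K : PrecubicalSet.{u}} {n : ℕ+} {α β : K.cubes 0}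
    {γ : C(Set.Icc (0 : ℝ) n, K.Geom)} (h : γ ∈ K.naturalPaths n α β) :
    extend γ n = K.vertex β := by
  obtain ⟨p, -, hp⟩ := h.1
  have hn : (n : ℝ) ≠ 0 := Nat.cast_ne_zero.2 n.ne_zero
  rw [show extend γ n = _ from (extend_apply γ ⟨n, Nat.cast_nonneg _, le_rfl⟩).trans (hp _)]
  simp [hn]

theorem naturalPaths_composable {K : PrecubicalSet.{u}} {m n : ℕ+} {α β γ : K.cubes 0}
    {γ₁ : C(Set.Icc (0 : ℝ) m, K.Geom)} {γ₂ : C(Set.Icc (0 : ℝ) n, K.Geom)}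
    (h₁ : γ₁ ∈ K.naturalPaths m α β) (h₂ : γ₂ ∈ K.naturalPaths n β γ) :
    extend γ₁ m = extend γ₂ 0 := by
  rw [naturalPaths_target h₁, naturalPaths_source h₂]

namespace NaturalPath

variable {K : PrecubicalSet.{u}} {m n : ℕ+} {α β γ : K.cubes 0}

/-- The underlying path. -/
def path (c : K.NaturalPath n α β) : C(Set.Icc (0 : ℝ) n, K.Geom) :=
  (WithGeneratedByTopology.equiv c).1

theorem mem (c : K.NaturalPath n α β) : c.path ∈ K.naturalPaths n α β :=
  (WithGeneratedByTopology.equiv c).2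

/-- Constructor. -/
def mk (p : C(Set.Icc (0 : ℝ) n, K.Geom)) (h : p ∈ K.naturalPaths n α β) : K.NaturalPath n α β :=
  WithGeneratedByTopology.equiv.symm ⟨p, h⟩

@[ext]
theorem ext {c d : K.NaturalPath n α β} (h : c.path = d.path) : c = d :=
  WithGeneratedByTopology.equiv.injective (Subtype.ext h)

theorem continuous_path : Continuous (path : K.NaturalPath n α β → _) :=
  continuous_subtype_val.comp WithGeneratedByTopology.continuous_equiv

theorem deltaContinuous_mk {T : Type*} [TopologicalSpace T] {f : T → C(Set.Icc (0 : ℝ) n, K.Geom)}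
    (hf : Continuous f) (h : ∀ t, f t ∈ K.naturalPaths n α β) :
    DeltaContinuous fun t ↦ mk (f t) (h t) :=
  ContinuousGeneratedBy.comp
    (WithGeneratedByTopology.equivSymmAsContinuousMapGeneratedBy (fun n : ℕ ↦ Fin n → ℝ)
      (K.naturalPaths n α β)).prop
    (hf.subtype_mk h).continuousGeneratedBy

/-- The Moore composition of natural paths. -/
def comp (c : K.NaturalPath m α β) (d : K.NaturalPath n β γ) : K.NaturalPath (m + n) α γ :=
  mk (mooreComp c.path d.path (naturalPaths_composable c.mem d.mem))
    (naturalPaths_comp c.mem d.mem _)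

theorem extend_comp (c : K.NaturalPath m α β) (d : K.NaturalPath n β γ) (t : ℝ) :
    extend (c.comp d).path t = if t ≤ m then extend c.path t else extend d.path (t - m) :=
  extend_mooreComp _ _ (naturalPaths_composable c.mem d.mem) t

theorem continuous_extend_path :
    Continuous fun x : K.NaturalPath n α β × ℝ ↦ extend x.1.path x.2 := by
  have : ∀ x : K.NaturalPath n α β × ℝ, extend x.1.path x.2 =
      x.1.path (Set.projIcc 0 (n : ℝ) (Nat.cast_nonneg (n : ℕ)) x.2) := fun _ ↦ rfl
  simp only [this]
  exact continuous_eval.comp ((continuous_path.comp continuous_fst).prodMk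
    ((continuous_projIcc (h := Nat.cast_nonneg (n : ℕ))).comp continuous_snd))

theorem deltaContinuous_comp :
    DeltaContinuous fun x : K.NaturalPath m α β × K.NaturalPath n β γ ↦ comp x.1 x.2 := by
  refine deltaContinuous_mk (ContinuousMap.continuous_of_continuous_uncurry _ ?_) _
  change Continuous fun y : (K.NaturalPath m α β × K.NaturalPath n β γ) ×
    Set.Icc (0 : ℝ) (m + n : ℕ+) ↦ if (y.2 : ℝ) ≤ m then extend y.1.1.path y.2
      else extend y.1.2.path (y.2 - m)
  refine Continuous.if_le
    (continuous_extend_path.comp ((continuous_fst.comp continuous_fst).prodMk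
      (continuous_subtype_val.comp continuous_snd)))
    (continuous_extend_path.comp ((continuous_snd.comp continuous_fst).prodMk
      ((continuous_subtype_val.comp continuous_snd).sub continuous_const)))
    (by fun_prop) (by fun_prop) ?_
  intro y hy
  rw [hy, sub_self]
  exact naturalPaths_composable y.1.1.mem y.1.2.mem

/-- The image of a natural path. -/
def map {K L : PrecubicalSet.{u}} (f : K ⟶ L) {n : ℕ+} {α β : K.cubes 0}
    (c : K.NaturalPath n α β) : L.NaturalPath n (f.app _ α) (f.app _ β) :=
  mk ((geomMap f).comp c.path) (by
    obtain ⟨⟨p, hp, e⟩, h⟩ := c.mem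
    refine ⟨⟨(p.map (geomMap f).continuous).cast (geomMap_cube f α _).symm
      (geomMap_cube f β _).symm, ?_, fun t ↦ ?_⟩, fun t ht ↦ (h t ht).map f⟩
    · exact MdTop.IsExec.congr ((tameRegularRealization.map f).map_exec hp) fun t ↦ rfl
    · exact congrArg (geomMap f) (e t))

theorem continuous_map {K L : PrecubicalSet.{u}} (f : K ⟶ L) {n : ℕ+} {α β : K.cubes 0} :
    Continuous (map f : K.NaturalPath n α β → _) := by
  refine DeltaContinuous.continuous (deltaContinuous_mk ?_ _)
  exact ((geomMap f).continuous_postcomp).comp continuous_path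

end NaturalPath

theorem sigma_ext {K : PrecubicalSet.{u}} {α β : K.cubes 0}
    {x y : Σ n : ℕ+, K.NaturalPath n α β} (h : x.1 = y.1)
    (e : ∀ t, extend x.2.path t = extend y.2.path t) : x = y := by
  obtain ⟨m, x⟩ := x
  obtain ⟨n, y⟩ := y
  obtain rfl : m = n := h
  congr 1
  refine NaturalPath.ext (ContinuousMap.ext fun t ↦ ?_)
  rw [← extend_apply, ← extend_apply]
  exact e t

/-- The composition of natural paths of arbitrary lengths. -/
def sigmaComp {K : PrecubicalSet.{u}} {α β γ : K.cubes 0} (x : Σ n : ℕ+, K.NaturalPath n α β)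
    (y : Σ n : ℕ+, K.NaturalPath n β γ) : Σ n : ℕ+, K.NaturalPath n α γ :=
  ⟨x.1 + y.1, x.2.comp y.2⟩

/-- The tame concrete realization `|K|_tc` of `K`: the states are the vertices of `K`, the space of
execution paths from `α` to `β` is the disjoint sum of the spaces `N^n_{α,β}(K)` for `n ≥ 1`, and
the composition is the Moore composition. -/
def tameConcreteObj (K : PrecubicalSet.{u}) : Flow.{u} where
  states := K.cubes 0
  path α β := Σ n : ℕ+, K.NaturalPath n α β
  comp := sigmaComp
  comp_continuous α β γ := by
    intro k f
    obtain ⟨m, g₁, hg₁, e₁⟩ := (continuous_fst.comp f.continuous).exists_lift_sigma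
    obtain ⟨n, g₂, hg₂, e₂⟩ := (continuous_snd.comp f.continuous).exists_lift_sigma
    have h := NaturalPath.deltaContinuous_comp (K := K) (α := α) (β := β) (γ := γ) (m := m)
      (n := n) ⟨_, hg₁.prodMk hg₂⟩
    have h' : Continuous fun x ↦
        (⟨m + n, (g₁ x).comp (g₂ x)⟩ : Σ n : ℕ+, K.NaturalPath n α γ) :=
      continuous_sigmaMk.comp h
    convert h' using 1
    funext x
    have a₁ : (f x).1 = ⟨m, g₁ x⟩ := congrFun e₁ x
    have a₂ : (f x).2 = ⟨n, g₂ x⟩ := congrFun e₂ x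
    exact congrArg₂ sigmaComp a₁ a₂
  comp_assoc x y z := by
    refine sigma_ext (add_assoc _ _ _) fun t ↦ ?_
    change extend ((x.2.comp y.2).comp z.2).path t = extend (x.2.comp (y.2.comp z.2)).path t
    have hxy : ((x.1 + y.1 : ℕ+) : ℝ) = x.1 + y.1 := by push_cast; rfl
    have hy : (0 : ℝ) < y.1 := Nat.cast_pos.2 y.1.pos
    simp only [NaturalPath.extend_comp, hxy]
    split_ifs
    · rfl
    · rfl
    · linarith
    · linarith
    · exfalso; linarith
    · congr 1; ring

theorem continuous_sigma_map {K L : PrecubicalSet.{u}} (f : K ⟶ L) (α β : K.cubes 0) :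
    Continuous fun x : (Σ n : ℕ+, K.NaturalPath n α β) ↦
      (⟨x.1, x.2.map f⟩ : Σ n : ℕ+, L.NaturalPath n (f.app _ α) (f.app _ β)) :=
  continuous_sigma fun _ ↦ continuous_sigmaMk.comp (NaturalPath.continuous_map f)

theorem map_comp_natural {K L : PrecubicalSet.{u}} (f : K ⟶ L) {m n : ℕ+} {α β γ : K.cubes 0}
    (x : K.NaturalPath m α β) (y : K.NaturalPath n β γ) :
    (x.comp y).map f = (x.map f).comp (y.map f) := by
  refine NaturalPath.ext (ContinuousMap.ext fun t ↦ ?_)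
  exact apply_ite (geomMap f) _ _ _

/-- The tame concrete realization functor. -/
def tameConcreteRealization : PrecubicalSet.{u} ⥤ Flow.{u} where
  obj K := K.tameConcreteObj
  map {K L} f :=
    { onStates := fun α : K.cubes 0 ↦ (f.app _ α : L.cubes 0)
      onPaths := fun x ↦ ⟨x.1, x.2.map f⟩
      continuous_onPaths := continuous_sigma_map f
      onPaths_comp := fun x y ↦ congrArg (Sigma.mk _) (map_comp_natural f x.2 y.2) }
  map_id K := by
    refine Flow.Hom.ext rfl (heq_of_eq ?_)
    funext α β x
    refine sigma_ext rfl fun t ↦ ?_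
    exact geomMap_id K _
  map_comp f g := by
    refine Flow.Hom.ext rfl (heq_of_eq ?_)
    funext α β x
    refine sigma_ext rfl fun t ↦ ?_
    exact geomMap_comp f g _

end PrecubicalSet

end DirectedSpace

end

/-! The sum of the coordinates of a cube changes by an integer under a coface map, so modulo 1 it
glues to a continuous map from the geometric realization to the circle, the phase. Along a piece
`|c|_geom ∘ δ` with `δ` nondecreasing, the `L₁`-arc length is the increment of the coordinate sum of
`δ`. Hence the length of any `d`-path is the increment of any continuous real lift of its phase
(`HasL1Length.eq_sub`), whatever the decomposition into pieces.

Vertices have phase 0. An execution path between vertices therefore has a unique lift of its phase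
starting at 0, given by the covering `ℝ → ℝ/ℤ` (`phaseLift`). Regularity makes this lift strictly
increasing (`strictMono_lift`), and its final value is an integer `n ≥ 1` (`exists_phaseLift_one`).
The lift divided by `n` is then an automorphism of `[0,1]`, and reparametrizing by its inverse gives
a natural path of length `n` (`naturalize_mem`). So every class modulo reparametrization contains a
natural path. It contains only one, because along a natural path the lift is the parameter itself
(`phaseLift_unit`, `toTrace_injective`).

The resulting bijection `toTrace`, from natural paths to classes, involves no choice, which makes
its continuity and its naturality direct. Its inverse is continuous because continuity can be tested
on the spaces `ℝ^k`: over such a connected space the length is constant, and the lifts and the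
inverse reparametrizations vary continuously (`continuous_ofExec`). Moore composition corresponds to
normalized composition because the two differ by a reparametrization (`toTrace_sigmaComp`).

The colimit is accessed only through its universal property, by mapping it to test objects: a
codiscrete space separates the vertices, the circle defines the phase, and the realization itself
with fewer states or fewer execution paths yields an induction principle (`exists_section`,
`isExec_induction`). -/

noncomputable section

namespace DirectedSpace

/-! ### Codiscrete multipointed `d`-spaces as test objects. -/

namespace MdTop

/-- The multipointed `d`-space on a set all of whose paths are execution paths, with the
`Δ`-kelleyfication of the indiscrete topology. -/
def codiscrete (A : Type u) : MdTop.{u} :=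
  letI : TopologicalSpace A := ⊤
  { carrier := DeltaGeneratedSpace.of (Y := A)
    states := Set.univ
    IsExec := fun _ ↦ True
    source_mem := fun _ ↦ trivial
    target_mem := fun _ ↦ trivial
    reparam_mem := fun _ _ ↦ trivial
    trans_mem := fun _ _ ↦ trivial }

/-- Any map of sets gives a map to the codiscrete multipointed `d`-space. -/
def toCodiscrete {X : MdTop.{u}} {A : Type u} (f : X.carrier → A) : X ⟶ codiscrete A :=
  letI : TopologicalSpace A := ⊤
  { map := ⟨fun x ↦ (WithGeneratedByTopology.equiv (X := fun n : ℕ ↦ Fin n → ℝ) (Y := A)).symm (f x),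
      -- The source is `Δ`-generated, so continuity into the `Δ`-kelleyfication amounts to
      -- continuity into the indiscrete topology.
      (IsGeneratedBy.equiv_symm_comp_continuous_iff (fun n : ℕ ↦ Fin n → ℝ) f).2 continuous_top⟩
    map_states := fun _ _ ↦ trivial
    map_exec := fun _ ↦ trivial }

end MdTop

namespace PrecubicalSet

/-! ## Maps out of the realization -/

section Desc

variable (K : PrecubicalSet.{u}) {Z : MdTop.{u}}
  (g : ∀ (b : Box) (_ : K.obj (Opposite.op b)), regularCubes.{u}.obj b ⟶ Z)
  (hg : ∀ {a b : Box} (f : a ⟶ b) (c : K.obj (Opposite.op b)),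
    regularCubes.map f ≫ g b c = g a (K.map f.op c))

/-- The map out of the realization given by a compatible family of maps out of the cubes. -/
def descCells : colimit K.diagram ⟶ Z :=
  colimit.desc K.diagram
    { pt := Z
      ι :=
        { app j := g j.unop.1.unop j.unop.2
          naturality j k f := by
            refine (hg f.unop.1.unop k.unop.2).trans ?_
            refine Eq.trans ?_ (Category.comp_id _).symm
            exact congrArg (g j.unop.1.unop) f.unop.2 } }

theorem cell_descCells {b : Box} (c : K.obj (Opposite.op b)) :
    K.cell c ≫ K.descCells g hg = g b c :=
  colimit.ι_desc _ _

theorem descCells_cube {n : ℕ} (c : K.cubes n) (x : Fin n → I) :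
    (K.descCells g hg).map (K.cube c x) = (g ⟨n⟩ c).map (ULift.up x) :=
  congrArg (fun h ↦ MdTop.Hom.map h (ULift.up x)) (K.cell_descCells g hg c)

end Desc

/-- If a multipointed `d`-space over the realization receives all cubes, it has a section. -/
theorem exists_section (K : PrecubicalSet.{u}) {Z : MdTop.{u}}
    (i : Z ⟶ colimit K.diagram) (hi : Function.Injective i.map)
    (h : ∀ (b : Box) (c : K.obj (Opposite.op b)),
      ∃ g : regularCubes.{u}.obj b ⟶ Z, g ≫ i = K.cell c) :
    ∃ s : colimit K.diagram ⟶ Z, s ≫ i = 𝟙 _ := by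
  choose g hg using h
  have hg' : ∀ {a b : Box} (f : a ⟶ b) (c : K.obj (Opposite.op b)),
      regularCubes.map f ≫ g b c = g a (K.map f.op c) := by
    intro a b f c
    -- The lifts are chosen independently, but injectivity of `i` forces them to be compatible: the
    -- cells of the realization already are.
    refine MdTop.hom_ext fun x ↦ hi ?_
    have e : (regularCubes.map f ≫ g b c) ≫ i = g a (K.map f.op c) ≫ i := by
      rw [Category.assoc, hg, hg, K.cell_face]
    exact congrArg (fun k ↦ MdTop.Hom.map k x) e
  refine ⟨K.descCells g hg', K.realization_hom_ext fun b c ↦ ?_⟩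
  rw [← Category.assoc, cell_descCells, hg]
  exact (Category.comp_id _).symm

theorem cube_face (K : PrecubicalSet.{u}) {a b : Box} (f : a ⟶ b) (c : K.obj (Opposite.op b))
    (x : Fin a.dim → I) :
    K.cube (n := b.dim) c (cubeMap f.1 x) = K.cube (n := a.dim) (K.map f.op c) x :=
  congrArg (fun h ↦ MdTop.Hom.map h (ULift.up x)) (K.cell_face f c)

/-- Every execution path of the realization has a property that holds for the execution paths of
the cubes and is stable under reparametrization and normalized composition. -/
theorem isExec_induction {K : PrecubicalSet.{u}} {P : ∀ {x y : K.Geom}, Path x y → Prop}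
    (of : ∀ {n : ℕ} (c : K.cubes n) {x y : (regularCube.{u} n).carrier} (γ : Path x y),
      (regularCube n).IsExec γ → P (γ.map (K.cell c).map.continuous))
    (reparam : ∀ {x y : K.Geom} (γ : Path x y) (φ : I ≃o I), P γ → P (reparam γ φ))
    (trans : ∀ {x y z : K.Geom} (γ₁ : Path x y) (γ₂ : Path y z), P γ₁ → P γ₂ → P (γ₁.trans γ₂))
    {x y : K.Geom} {γ : Path x y} (h : (tameRegularRealization.obj K).IsExec γ) : P γ := by
  -- The realization with only those execution paths that satisfy `P`. All cubes map to it, so the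
  -- identity of the realization factors through it, and every execution path satisfies `P`.
  let Z : MdTop.{u} :=
    { carrier := K.Geom
      states := (tameRegularRealization.obj K).states
      IsExec := fun γ ↦ (tameRegularRealization.obj K).IsExec γ ∧ P γ
      source_mem := fun h ↦ MdTop.source_mem _ h.1
      target_mem := fun h ↦ MdTop.target_mem _ h.1
      reparam_mem := fun φ h ↦ ⟨MdTop.reparam_mem _ φ h.1, reparam _ φ h.2⟩
      trans_mem := fun h h' ↦ ⟨MdTop.trans_mem _ h.1 h'.1, trans _ _ h.2 h'.2⟩ }
  let i : Z ⟶ tameRegularRealization.obj K :=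
    ⟨ContinuousMap.id _, fun _ h ↦ h, fun h ↦ h.1⟩
  obtain ⟨s, hs⟩ := K.exists_section i (fun _ _ e ↦ e) fun b c ↦
    ⟨⟨(K.cell c).map, (K.cell c).map_states, fun h ↦ ⟨(K.cell c).map_exec h, of c _ h⟩⟩, rfl⟩
  have e : ∀ x, s.map x = x := fun x ↦ congrArg (fun k ↦ MdTop.Hom.map k x) hs
  have h' : Z.IsExec γ := MdTop.IsExec.congr (X := Z) (s.map_exec h) fun t ↦ (e _).symm
  exact h'.2

/-! ## Vertices -/

/-- A vertex of `{0,1}^n` is built from the empty tuple by inserting its coordinates one at a time,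
the first coordinate being inserted last. -/
theorem isBoxMap_const : ∀ {n : ℕ} (ε : Fin n → Bool), IsBoxMap fun _ : Fin 0 → Bool ↦ ε
  | 0, ε => by
    convert IsBoxMap.id 0 using 2
  | n + 1, ε => by
    have h := IsBoxMap.comp (isBoxMap_const fun i ↦ ε i.succ) (IsBoxMap.coface 0 (ε 0))
    convert h using 2
    funext i
    refine Fin.cases ?_ (fun j ↦ ?_) i <;> simp [coface]

/-- The map `[0] → [n]` of the box category given by a vertex. -/
def vertexMap {b : Box} (ε : Fin b.dim → Bool) : (⟨0⟩ : Box) ⟶ b := ⟨fun _ ↦ ε, isBoxMap_const ε⟩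

theorem vertexMap_comp {a b : Box} (ε : Fin a.dim → Bool) (f : a ⟶ b) :
    vertexMap ε ≫ f = vertexMap (f.1 ε) := rfl

/-- The point of `{0,1}^n` given by a vertex of `[0,1]^n`. -/
def toBool {n : ℕ} (x : Fin n → I) (i : Fin n) : Bool := decide (x i = 1)

/-- The converse direction holds because every coordinate of `x` reappears among the coordinates of
`cubeMap f x`. -/
theorem _root_.DirectedSpace.IsBoxMap.isVertex_cubeMap_iff {m n : ℕ}
    {f : (Fin m → Bool) → (Fin n → Bool)} (hf : IsBoxMap f) {x : Fin m → I} :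
    IsVertex (cubeMap f x) ↔ IsVertex x := by
  refine ⟨fun h j ↦ ?_, hf.isVertex_cubeMap⟩
  obtain ⟨i, hi⟩ := hf.exists_coordinate j
  rw [← cubeMap_of_proj hi x]
  exact h i

/-- No vertex hypothesis is required: each coordinate of `f` is a constant or a projection, and
`toBool` acts coordinatewise. -/
theorem toBool_cubeMap {m n : ℕ} {f : (Fin m → Bool) → (Fin n → Bool)} (hf : IsBoxMap f)
    (x : Fin m → I) : toBool (cubeMap f x) = f (toBool x) := by
  funext i
  rcases hf.coordinate i with ⟨b, hb⟩ | ⟨j, hj⟩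
  · rw [hb, toBool, cubeMap_of_const hb]; cases b <;> simp
  · rw [hj, toBool, cubeMap_of_proj hj]; rfl

/-- The point `x` is the image of the unique point of the 0-cube under `vertexMap (toBool x)`, so
the gluing relation `cube_face` identifies it with a 0-cube of `K`. -/
theorem cube_eq_vertex (K : PrecubicalSet.{u}) {n : ℕ} (c : K.cubes n) {x : Fin n → I}
    (hx : IsVertex x) :
    K.cube c x = K.vertex (K.map (vertexMap (b := ⟨n⟩) (toBool x)).op c) := by
  rw [vertex]
  refine Eq.trans ?_ (K.cube_face (vertexMap (b := ⟨n⟩) (toBool x)) c Fin.elim0)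
  congr 1
  funext i
  refine Eq.trans ?_ (cubeMap_of_const (b := toBool x i) (fun _ ↦ rfl) _).symm
  rcases hx i with h | h <;> simp [toBool, h]

open Classical in
/-- The vertex of a cube at a given point of the topological cube, if this point is a vertex. -/
def vertexAt (K : PrecubicalSet.{u}) {b : Box} (c : K.obj (Opposite.op b))
    (x : Fin b.dim → I) : Option (K.cubes 0) :=
  if IsVertex x then some (K.map (vertexMap (toBool x)).op c) else none

theorem vertexAt_cubeMap (K : PrecubicalSet.{u}) {a b : Box} (f : a ⟶ b)
    (c : K.obj (Opposite.op b)) (x : Fin a.dim → I) :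
    K.vertexAt c (cubeMap f.1 x) = K.vertexAt (K.map f.op c) x := by
  have h : K.map (vertexMap (toBool (cubeMap f.1 x))).op c =
      K.map (vertexMap (toBool x)).op (K.map f.op c) := by
    rw [toBool_cubeMap f.2, ← vertexMap_comp, op_comp, Functor.map_comp]
    rfl
  classical
  rw [vertexAt, vertexAt, h]
  exact if_congr f.2.isVertex_cubeMap_iff rfl rfl

/-- The function `vertexAt` is compatible with faces, hence descends to the realization, where it is
a left inverse of `K.vertex` up to `some`. The codiscrete target removes all conditions of
continuity and direction, so the colimit can be used as a colimit of sets. -/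
theorem vertex_injective (K : PrecubicalSet.{u}) : Function.Injective K.vertex := by
  let g : ∀ (b : Box) (_ : K.obj (Opposite.op b)),
      regularCubes.{u}.obj b ⟶ MdTop.codiscrete (Option (K.cubes 0)) :=
    fun b c ↦ MdTop.toCodiscrete fun x ↦ K.vertexAt c x.down
  let d := K.descCells g fun f c ↦ MdTop.hom_ext fun x ↦ K.vertexAt_cubeMap f c x.down
  have e : ∀ α, d.map (K.vertex α) = some α := by
    intro α
    refine (K.descCells_cube g _ α _).trans ?_
    change K.vertexAt α Fin.elim0 = some α
    have hv : IsVertex (n := 0) Fin.elim0 := fun i ↦ i.elim0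
    rw [vertexAt, if_pos hv]
    congr 1
    -- The set `{0,1}^0` is a singleton, so the only map `[0] → [0]` is the identity.
    have h : vertexMap (b := ⟨0⟩) (toBool Fin.elim0) = 𝟙 _ :=
      Subtype.ext (funext fun ε ↦ Subsingleton.elim _ _)
    rw [h]
    exact ConcreteCategory.congr_hom (K.map_id _) α
  intro α β h
  exact Option.some_injective _ ((e α).symm.trans ((congrArg d.map h).trans (e β)))

theorem vertex_mem_states (K : PrecubicalSet.{u}) (α : K.cubes 0) :
    K.vertex α ∈ (tameRegularRealization.obj K).states :=
  (K.cell α).map_states _ fun i ↦ i.elim0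

/-- Shrinking the set of states to the range of `K.vertex`, and keeping only the execution paths
with end points there, leaves an object that still receives all cubes. By `exists_section` the
identity of the realization maps states into this smaller set. -/
theorem exists_vertex_of_mem_states (K : PrecubicalSet.{u}) {x : K.Geom}
    (hx : x ∈ (tameRegularRealization.obj K).states) : ∃ α, K.vertex α = x := by
  have of : ∀ {n : ℕ} (c : K.cubes n) (x : (regularCube.{u} n).carrier),
      IsVertex x.down → (K.cell c).map x ∈ Set.range K.vertex :=
    fun c x hx ↦ ⟨_, (K.cube_eq_vertex c hx).symm⟩
  let Z : MdTop.{u} :=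
    { carrier := K.Geom
      states := Set.range K.vertex
      IsExec := fun {x y} γ ↦ (tameRegularRealization.obj K).IsExec γ ∧ x ∈ Set.range K.vertex ∧
        y ∈ Set.range K.vertex
      source_mem := fun h ↦ h.2.1
      target_mem := fun h ↦ h.2.2
      reparam_mem := fun φ h ↦ ⟨MdTop.reparam_mem _ φ h.1, h.2⟩
      trans_mem := fun h h' ↦ ⟨MdTop.trans_mem _ h.1 h'.1, h.2.1, h'.2.2⟩ }
  let i : Z ⟶ tameRegularRealization.obj K :=
    ⟨ContinuousMap.id _, by rintro _ ⟨α, rfl⟩; exact K.vertex_mem_states α, fun h ↦ h.1⟩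
  obtain ⟨s, hs⟩ := K.exists_section i (fun _ _ e ↦ e) fun b c ↦
    ⟨⟨(K.cell c).map, fun x hx ↦ of c x hx,
      fun h ↦ ⟨(K.cell c).map_exec h, of c _ h.1, of c _ h.2.1⟩⟩, rfl⟩
  have e : s.map x = x := congrArg (fun k ↦ MdTop.Hom.map k x) hs
  have := s.map_states x hx
  rwa [e] at this

end PrecubicalSet

/-! ## The phase of a point of the realization -/

/-- The circle is a quotient of `ℝ`. This is what allows it to underlie a multipointed `d`-space and
so to be a target for maps out of the realization. -/
instance deltaGenerated_circle : DeltaGeneratedSpace (ULift.{u} UnitAddCircle) := by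
  have h : IsQuotientMap fun x : Fin 1 → ℝ ↦ (ULift.up (x 0 : UnitAddCircle) : ULift.{u} _) :=
    Homeomorph.ulift.symm.isQuotientMap.comp (isQuotientMap_quotient_mk'.comp
      (Homeomorph.funUnique (Fin 1) ℝ).isQuotientMap)
  exact h.isGeneratedBy

/-- The circle, all of whose paths are execution paths. -/
def MdTop.circle : MdTop.{u} where
  carrier := ULift.{u} UnitAddCircle
  states := Set.univ
  IsExec _ := True
  source_mem _ := trivial
  target_mem _ := trivial
  reparam_mem _ _ := trivial
  trans_mem _ _ := trivial

/-- A coface map inserts a coordinate 0 or 1 and so changes the sum by an integer. This is why the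
coordinate sum glues over the realization modulo 1, although not as a real function. -/
theorem IsBoxMap.sum_cubeMap {m n : ℕ} {f : (Fin m → Bool) → (Fin n → Bool)} (hf : IsBoxMap f)
    (x : Fin m → I) :
    ((∑ i, (cubeMap f x i : ℝ) : ℝ) : UnitAddCircle) = ((∑ j, (x j : ℝ) : ℝ) : UnitAddCircle) := by
  induction hf with
  | id n => rw [cubeMap_id]
  | coface k α =>
    rw [cubeMap_coface, Fin.sum_univ_succAbove _ k]
    cases α <;> simp
  | comp _ hg ihf ihg => rw [cubeMap_comp _ hg, ihg, ihf]

/-- Two real functions on an interval that agree modulo `1` have the same increment. -/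
theorem sub_eq_sub_of_coe_eq {F G : ℝ → ℝ} {a b : ℝ} (hab : a ≤ b)
    (hF : ContinuousOn F (Set.Icc a b)) (hG : ContinuousOn G (Set.Icc a b))
    (h : ∀ t ∈ Set.Icc a b, (F t : UnitAddCircle) = G t) : F b - F a = G b - G a := by
  have hd : _root_.IsDiscrete (Set.range ((↑) : ℤ → ℝ)) :=
    Int.isClosedEmbedding_coe_real.isInducing.isDiscrete_range
  -- The difference `F - G` is continuous on a connected interval with values in the discrete set of
  -- integers, hence constant.
  have := isPreconnected_Icc.constant_of_mapsTo (S := Set.Icc a b) hd (hF.sub hG) (fun t ht ↦ by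
    have h0 : ((F t - G t : ℝ) : UnitAddCircle) = 0 := by rw [AddCircle.coe_sub, h t ht, sub_self]
    obtain ⟨n, hn⟩ := (AddCircle.coe_eq_zero_iff 1).1 h0
    exact ⟨n, by simpa using hn⟩) (Set.left_mem_Icc.2 hab) (Set.right_mem_Icc.2 hab)
  simp only [Pi.sub_apply] at this
  linarith

namespace PrecubicalSet

theorem continuous_sum_coord {n : ℕ} : Continuous fun x : Fin n → I ↦ ∑ i, (x i : ℝ) := by
  fun_prop

/-- The map from a cube to the circle that is the sum of the coordinates. -/
def cubeToCircle (b : Box) : regularCubes.{u}.obj b ⟶ MdTop.circle.{u} where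
  map := ⟨fun x ↦ ULift.up ((∑ i, (x.down i : ℝ) : ℝ) : UnitAddCircle),
    continuous_uliftUp.comp ((AddCircle.continuous_mk' 1).comp
      (continuous_sum_coord.comp continuous_uliftDown))⟩
  map_states _ _ := trivial
  map_exec _ := trivial

theorem map_cubeToCircle {a b : Box} (f : a ⟶ b) :
    regularCubes.map f ≫ cubeToCircle.{u} b = cubeToCircle a :=
  MdTop.hom_ext fun x ↦ congrArg ULift.up (f.2.sum_cubeMap x.down)

/-- The map from the realization to the circle that is the sum of the coordinates on each cube. -/
def toCircle (K : PrecubicalSet.{u}) : colimit K.diagram ⟶ MdTop.circle.{u} :=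
  K.descCells (fun b _ ↦ cubeToCircle b) fun f _ ↦ map_cubeToCircle f

/-- The phase of a point of the realization: the sum of its coordinates modulo `1`. -/
def phase (K : PrecubicalSet.{u}) (x : K.Geom) : UnitAddCircle := (K.toCircle.map x).down

theorem continuous_phase (K : PrecubicalSet.{u}) : Continuous K.phase :=
  continuous_uliftDown.comp K.toCircle.map.continuous

theorem phase_cube (K : PrecubicalSet.{u}) {n : ℕ} (c : K.cubes n) (x : Fin n → I) :
    K.phase (K.cube c x) = ((∑ i, (x i : ℝ) : ℝ) : UnitAddCircle) :=
  congrArg ULift.down (K.descCells_cube (fun b _ ↦ cubeToCircle b) (fun f _ ↦ map_cubeToCircle f) c x)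

theorem phase_vertex (K : PrecubicalSet.{u}) (α : K.cubes 0) : K.phase (K.vertex α) = 0 := by
  rw [vertex, phase_cube]
  simp

/-! ## Properties of the `L₁`-arc length -/

namespace HasL1Length

variable {K : PrecubicalSet.{u}} {γ : ℝ → K.Geom} {a b s : ℝ}

/-- The `L₁`-arc length is the increment of any lift of the phase. -/
theorem eq_sub (h : HasL1Length K γ a b s) {F : ℝ → ℝ} (hF : ContinuousOn F (Set.Icc a b))
    (e : ∀ t ∈ Set.Icc a b, (F t : UnitAddCircle) = K.phase (γ t)) : s = F b - F a := by
  induction h with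
  | @cube a b hab n c δ hc hm he =>
    -- The coordinate sum of `δ` is another lift of the phase on this piece. Its increment is the
    -- length, since `δ` is nondecreasing and the absolute values can be dropped.
    have h1 := sub_eq_sub_of_coe_eq hab hF (continuous_sum_coord.comp_continuousOn hc)
      fun t ht ↦ by rw [e t ht, he t ht, phase_cube]; rfl
    rw [h1]
    simp only [Function.comp_apply]
    rw [← Finset.sum_sub_distrib]
    refine Finset.sum_congr rfl fun i _ ↦ abs_of_nonneg (sub_nonneg.2 ?_)
    exact hm (Set.left_mem_Icc.2 hab) (Set.right_mem_Icc.2 hab) hab i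
  | concat h h' ih ih' =>
    rw [ih (hF.mono (Set.Icc_subset_Icc_right h'.le)) fun t ht ↦
        e t ⟨ht.1, ht.2.trans h'.le⟩,
      ih' (hF.mono (Set.Icc_subset_Icc_left h.le)) fun t ht ↦ e t ⟨h.le.trans ht.1, ht.2⟩]
    ring

/-- The `L₁`-arc length is invariant under nondecreasing changes of the parameter. -/
theorem comp_monotoneOn (h : HasL1Length K γ a b s) {γ' : ℝ → K.Geom} {φ : ℝ → ℝ} {a' b' : ℝ}
    (hab : a' ≤ b') (hφ : ContinuousOn φ (Set.Icc a' b')) (hm : MonotoneOn φ (Set.Icc a' b'))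
    (ha : φ a' = a) (hb : φ b' = b) (e : ∀ t ∈ Set.Icc a' b', γ' t = γ (φ t)) :
    HasL1Length K γ' a' b' s := by
  induction h generalizing a' b' with
  | @cube a b _ n c δ hc hmδ he =>
    have hmap : Set.MapsTo φ (Set.Icc a' b') (Set.Icc a b) := fun t ht ↦
      ⟨ha ▸ hm (Set.left_mem_Icc.2 hab) ht ht.1, hb ▸ hm ht (Set.right_mem_Icc.2 hab) ht.2⟩
    have := HasL1Length.cube (K := K) (γ := γ') hab c (δ ∘ φ) (hc.comp hφ hmap)
      (hmδ.comp hm hmap) fun t ht ↦ by rw [e t ht, he _ (hmap ht)]; rfl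
    simpa [ha, hb] using this
  | @concat a m b _ _ h h' ih ih' =>
    -- The cut point `m` is a value of `φ`. Any preimage `m'` cuts `[a',b']` into two intervals to
    -- which the induction hypotheses apply, even if `φ` is not injective.
    obtain ⟨m', hm', rfl⟩ := intermediate_value_Icc hab hφ
      (show m ∈ Set.Icc (φ a') (φ b') from ⟨ha ▸ h.le, hb ▸ h'.le⟩)
    have i₁ : Set.Icc a' m' ⊆ Set.Icc a' b' := Set.Icc_subset_Icc_right hm'.2
    have i₂ : Set.Icc m' b' ⊆ Set.Icc a' b' := Set.Icc_subset_Icc_left hm'.1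
    exact concat (ih hm'.1 (hφ.mono i₁) (hm.mono i₁) ha rfl fun t ht ↦ e t (i₁ ht))
      (ih' hm'.2 (hφ.mono i₂) (hm.mono i₂) rfl hb fun t ht ↦ e t (i₂ ht))

/-- The restriction of a `d`-path to a smaller interval is a `d`-path. -/
theorem restrict (h : HasL1Length K γ a b s) {a' b' : ℝ} (ha : a ≤ a') (hab : a' ≤ b')
    (hb : b' ≤ b) : ∃ s', HasL1Length K γ a' b' s' := by
  induction h generalizing a' b' with
  | cube _ c δ hc hm he =>
    have i := Set.Icc_subset_Icc ha hb
    exact ⟨_, cube hab c δ (hc.mono i) (hm.mono i) fun t ht ↦ he t (i ht)⟩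
  | @concat a m b _ _ h h' ih ih' =>
    rcases le_total b' m with h1 | h1
    · exact ih ha hab h1
    · rcases le_total m a' with h2 | h2
      · exact ih' h2 hab hb
      · obtain ⟨_, e₁⟩ := ih ha h2 le_rfl
        obtain ⟨_, e₂⟩ := ih' le_rfl h1 hb
        exact ⟨_, e₁.concat e₂⟩

end HasL1Length

/-! ## Execution paths of the realization -/

/-- The execution paths of the realization are `d`-paths. -/
theorem exists_hasL1Length {K : PrecubicalSet.{u}} {x y : K.Geom} {p : Path x y}
    (hp : (tameRegularRealization.obj K).IsExec p) : ∃ s, HasL1Length K p.extend 0 1 s := by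
  refine isExec_induction (P := fun {x y} p ↦ ∃ s, HasL1Length K p.extend 0 1 s) ?_ ?_ ?_ hp
  · intro n c x y γ h
    exact ⟨_, HasL1Length.cube zero_le_one c (fun t ↦ (γ.extend t).down)
      (continuous_uliftDown.comp γ.continuous_extend).continuousOn
      (fun s _ t _ hst ↦ h.2.2.2.1 (Set.monotone_projIcc zero_le_one hst)) fun t _ ↦ rfl⟩
  · rintro x y γ φ ⟨s, h⟩
    refine ⟨s, h.comp_monotoneOn (φ := fun t ↦ (φ (Set.projIcc 0 1 zero_le_one t) : ℝ)) zero_le_one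
      (continuous_subtype_val.comp (φ.continuous.comp continuous_projIcc)).continuousOn
      (fun s _ t _ hst ↦ φ.monotone (Set.monotone_projIcc zero_le_one hst)) ?_ ?_ fun t ht ↦ ?_⟩
    · rw [Set.projIcc_left]; exact congrArg Subtype.val φ.map_bot
    · rw [Set.projIcc_right]; exact congrArg Subtype.val φ.map_top
    · rw [Path.extend_extends']; rfl
  · rintro x y z γ₁ γ₂ ⟨s₁, h₁⟩ ⟨s₂, h₂⟩
    refine ⟨s₁ + s₂, HasL1Length.concat (b := 1 / 2)
      (h₁.comp_monotoneOn (φ := fun t ↦ 2 * t) (by norm_num) (by fun_prop)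
        (fun s _ t _ hst ↦ by dsimp only; linarith) (by norm_num) (by norm_num) fun t ht ↦ ?_)
      (h₂.comp_monotoneOn (φ := fun t ↦ 2 * t - 1) (by norm_num) (by fun_prop)
        (fun s _ t _ hst ↦ by dsimp only; linarith) (by norm_num) (by norm_num) fun t ht ↦ ?_)⟩
    · exact Path.extend_trans_of_le_half _ _ ht.2
    · exact Path.extend_trans_of_half_le _ _ ht.1

/-- Any lift of the phase along an execution path of the realization is strictly increasing. -/
theorem strictMono_lift {K : PrecubicalSet.{u}} {x y : K.Geom} {p : Path x y}
    (hp : (tameRegularRealization.obj K).IsExec p) {F : I → ℝ} (hF : Continuous F)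
    (e : ∀ t, (F t : UnitAddCircle) = K.phase (p t)) : StrictMono F := by
  -- The induction ranges over all lifts, with no value prescribed at `0`: the restriction of a lift
  -- to the second half of a composite starts at an arbitrary value.
  refine isExec_induction (P := fun {x y} p ↦ ∀ F : I → ℝ, Continuous F →
    (∀ t, (F t : UnitAddCircle) = K.phase (p t)) → StrictMono F) ?_ ?_ ?_ hp F hF e
  · intro n c x y γ h F hF e s t hst
    have hst' : (s : ℝ) < t := hst
    let F' : ℝ → ℝ := fun r ↦ F (Set.projIcc 0 1 zero_le_one r)
    let G : ℝ → ℝ := fun r ↦ ∑ i, ((γ.extend r).down i : ℝ)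
    have hd := sub_eq_sub_of_coe_eq (F := F') (G := G) hst'.le
      (hF.comp continuous_projIcc).continuousOn
      (continuous_sum_coord.comp (continuous_uliftDown.comp γ.continuous_extend)).continuousOn
      fun r _ ↦ (e _).trans (K.phase_cube c _)
    simp only [F', G, Set.projIcc_val, Path.extend_extends'] at hd
    have hle := h.2.2.2.1 hst.le
    have : T1Space (regularCube.{u} n).carrier := t1Space_cube n
    have hreg := (isRegular_iff γ.continuous).1 h.2.2.2.2 s t hst
    -- If the sums were equal, the coordinatewise inequality would give `γ s = γ t`. Then `γ`, being
    -- nondecreasing, would be constant on `[s,t]`, against regularity.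
    have hlt : ∑ i, ((γ s).down i : ℝ) < ∑ i, ((γ t).down i : ℝ) := by
      refine lt_of_le_of_ne (Finset.sum_le_sum fun i _ ↦ hle i) fun heq ↦ hreg ?_
      have hall := (Finset.sum_eq_sum_iff_of_le fun i _ ↦ Subtype.coe_le_coe.2 (hle i)).1 heq
      have hst_eq : (γ s).down = (γ t).down := funext fun i ↦
        Subtype.ext (hall i (Finset.mem_univ i))
      have hconst : ∀ r ∈ Set.Icc s t, γ r = γ s := fun r hr ↦ ULift.down_injective
        (le_antisymm ((h.2.2.2.1 hr.2).trans hst_eq.ge) (h.2.2.2.1 hr.1))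
      exact fun r hr r' hr' ↦ (hconst r hr).trans (hconst r' hr').symm
    linarith
  · intro x y γ φ ih F hF e
    have := ih (F ∘ φ.symm) (hF.comp φ.symm.continuous) fun t ↦ by
      rw [Function.comp_apply, e, reparam_apply, OrderIso.apply_symm_apply]
    simpa [Function.comp_def] using this.comp φ.strictMono
  · intro x y z γ₁ γ₂ ih₁ ih₂ F hF e
    have e' : ∀ r (hr : r ∈ I), (F ⟨r, hr⟩ : UnitAddCircle) =
        K.phase ((γ₁.trans γ₂).extend r) := fun r hr ↦ by
      rw [e, Path.extend_apply _ hr]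
    have hI₁ : ∀ t : I, (t : ℝ) / 2 ∈ I := fun t ↦ by
      constructor <;> linarith [t.2.1, t.2.2]
    have hI₂ : ∀ t : I, ((t : ℝ) + 1) / 2 ∈ I := fun t ↦ by
      constructor <;> linarith [t.2.1, t.2.2]
    -- Each half of `F`, rescaled to `[0,1]`, lifts the phase along the corresponding factor.
    have m₁ := ih₁ (fun t ↦ F ⟨t / 2, hI₁ t⟩)
      (by fun_prop) fun t ↦ by
        rw [e', Path.extend_trans_of_le_half _ _ (by linarith [t.2.2]),
          mul_div_cancel₀ _ two_ne_zero, Path.extend_extends']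
    have m₂ := ih₂ (fun t ↦ F ⟨(t + 1) / 2, hI₂ t⟩)
      (by fun_prop) fun t ↦ by
        rw [e', Path.extend_trans_of_half_le _ _ (by linarith [t.2.1]),
          mul_div_cancel₀ _ two_ne_zero, add_sub_cancel_right, Path.extend_extends']
    let half : I := ⟨1 / 2, by norm_num, by norm_num⟩
    have s₁ : StrictMonoOn F (Set.Iic half) := by
      intro s hs t ht hst
      have hs' : (s : ℝ) ≤ 1 / 2 := hs
      have ht' : (t : ℝ) ≤ 1 / 2 := ht
      have hst' : (s : ℝ) < t := hst
      have := m₁ (a := ⟨2 * s, by linarith [s.2.1], by linarith⟩)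
        (b := ⟨2 * t, by linarith [t.2.1], by linarith⟩) (show 2 * (s : ℝ) < 2 * t by linarith)
      simpa [mul_div_cancel_left₀] using this
    have s₂ : StrictMonoOn F (Set.Ici half) := by
      intro s hs t ht hst
      have hs' : 1 / 2 ≤ (s : ℝ) := hs
      have ht' : 1 / 2 ≤ (t : ℝ) := ht
      have hst' : (s : ℝ) < t := hst
      have := m₂ (a := ⟨2 * s - 1, by linarith, by linarith [s.2.2]⟩)
        (b := ⟨2 * t - 1, by linarith, by linarith [t.2.2]⟩)
        (show 2 * (s : ℝ) - 1 < 2 * t - 1 by linarith)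
      simpa [mul_div_cancel_left₀] using this
    exact s₁.Iic_union_Ici s₂

end PrecubicalSet

/-! ### Inverting a continuous family of reparametrizations. -/

/-- The inverses of a continuous family of automorphisms of `[0,1]` form a continuous family. -/
theorem continuous_symm_family {T : Type*} [TopologicalSpace T] {φ : T → I ≃o I}
    (h : Continuous fun x : T × I ↦ φ x.1 x.2) :
    Continuous fun x : T × I ↦ (φ x.1).symm x.2 := by
  -- Preimages of open rays suffice. The inverse disappears from them because `a < φ⁻¹ y` is
  -- equivalent to `φ a < y`, an open condition by joint continuity of `φ`.
  refine OrderTopology.continuous_iff.2 fun a ↦ ⟨?_, ?_⟩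
  · have e : (fun x : T × I ↦ (φ x.1).symm x.2) ⁻¹' Set.Ioi a = {x | φ x.1 a < x.2} := by
      ext x; simp [OrderIso.lt_symm_apply]
    rw [e]
    exact isOpen_lt (h.comp (continuous_fst.prodMk continuous_const)) continuous_snd
  · have e : (fun x : T × I ↦ (φ x.1).symm x.2) ⁻¹' Set.Iio a = {x | x.2 < φ x.1 a} := by
      ext x; simp [OrderIso.symm_apply_lt]
    rw [e]
    exact isOpen_lt continuous_snd (h.comp (continuous_fst.prodMk continuous_const))

namespace PrecubicalSet

variable {K : PrecubicalSet.{u}} {α β : K.cubes 0}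

/-! ## The lift of the phase along a path -/

section PhaseLift

variable {y : K.Geom}

/-- The lift to `ℝ` of the phase along a path that starts at a vertex. -/
def phaseLift (p : Path (K.vertex α) y) : C(I, ℝ) :=
  (AddCircle.isCoveringMap_coe (1 : ℝ)).liftPath ⟨fun t ↦ K.phase (p t),
    K.continuous_phase.comp p.continuous⟩ 0 (by simp [phase_vertex])

theorem coe_phaseLift (p : Path (K.vertex α) y) (t : I) :
    (phaseLift p t : UnitAddCircle) = K.phase (p t) :=
  congrFun ((AddCircle.isCoveringMap_coe (1 : ℝ)).liftPath_lifts _ _ _) t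

@[simp]
theorem phaseLift_zero (p : Path (K.vertex α) y) : phaseLift p 0 = 0 :=
  (AddCircle.isCoveringMap_coe (1 : ℝ)).liftPath_zero _ _ _

theorem eq_phaseLift {p : Path (K.vertex α) y} {F : I → ℝ} (hF : Continuous F)
    (e : ∀ t, (F t : UnitAddCircle) = K.phase (p t)) (h0 : F 0 = 0) : F = phaseLift p :=
  ((AddCircle.isCoveringMap_coe (1 : ℝ)).eq_liftPath_iff _).2 ⟨hF, funext e, h0⟩

/-- The lifts are continuous in time for each parameter, and continuous in the parameter at time 0,
where they all vanish. Since `ℝ → ℝ/ℤ` is a separated local homeomorphism, they are then jointly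
continuous. -/
theorem continuous_phaseLift {T : Type*} [TopologicalSpace T] {f : T → Path (K.vertex α) y}
    (hf : Continuous f) : Continuous fun x : T × I ↦ phaseLift (f x.1) x.2 := by
  have cov := AddCircle.isCoveringMap_coe (1 : ℝ)
  have hH : Continuous fun x : I × T ↦ K.phase (f x.2 x.1) :=
    K.continuous_phase.comp (continuous_eval.comp
      ((hf.comp continuous_snd).prodMk continuous_fst))
  have := cov.isLocalHomeomorph.continuous_lift cov.isSeparatedMap ⟨_, hH⟩
    (g := fun x ↦ phaseLift (f x.2) x.1) (funext fun x ↦ coe_phaseLift _ _)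
    (by simpa using continuous_const) fun a ↦ (phaseLift (f a)).continuous
  exact this.comp continuous_swap

end PhaseLift

/-- The target is a vertex, so its phase is 0 and the final value of the lift is an integer. It is
positive because the lift increases strictly from 0. -/
theorem exists_phaseLift_one {p : Path (K.vertex α) (K.vertex β)}
    (hp : (tameRegularRealization.obj K).IsExec p) : ∃ n : ℕ+, phaseLift p 1 = n := by
  have h1 : ((phaseLift p 1 : ℝ) : UnitAddCircle) = 0 := by
    rw [coe_phaseLift, Path.target, phase_vertex]
  obtain ⟨k, hk⟩ := (AddCircle.coe_eq_zero_iff 1).1 h1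
  have h2 := strictMono_lift hp (phaseLift p).continuous (coe_phaseLift p) (zero_lt_one' I)
  rw [phaseLift_zero, ← hk] at h2
  have hk0 : 0 < k := by simpa using h2
  refine ⟨⟨k.toNat, by omega⟩, ?_⟩
  rw [← hk]
  simp only [zsmul_eq_mul, mul_one, PNat.mk_coe]
  exact_mod_cast (Int.toNat_of_nonneg hk0.le).symm

/-! ## The natural parametrization -/

/-- The automorphism of `[0,1]` given by the normalized lift of the phase. -/
def phaseAut {p : Path (K.vertex α) (K.vertex β)} (hp : (tameRegularRealization.obj K).IsExec p)
    {n : ℕ+} (hn : phaseLift p 1 = n) : I ≃o I :=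
  have hm : StrictMono (phaseLift p) := strictMono_lift hp (phaseLift p).continuous
    (coe_phaseLift p)
  have hpos : (0 : ℝ) < n := Nat.cast_pos.2 n.pos
  autOfStrictMono
    (fun t ↦ ⟨phaseLift p t / n,
      div_nonneg (by rw [← phaseLift_zero p]; exact hm.monotone t.2.1) hpos.le,
      div_le_one_of_le₀ (by rw [← hn]; exact hm.monotone t.2.2) hpos.le⟩)
    (by fun_prop) (fun s t hst ↦ div_lt_div_of_pos_right (hm hst) hpos)
    (Subtype.ext (by simp)) (Subtype.ext (by simp [hn]))

theorem phaseAut_apply {p : Path (K.vertex α) (K.vertex β)}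
    (hp : (tameRegularRealization.obj K).IsExec p) {n : ℕ+} (hn : phaseLift p 1 = n) (t : I) :
    (phaseAut hp hn t : ℝ) = phaseLift p t / n := rfl

/-- The parametrization of an execution path by the `L₁`-arc length. -/
def naturalize {p : Path (K.vertex α) (K.vertex β)} (hp : (tameRegularRealization.obj K).IsExec p)
    {n : ℕ+} (hn : phaseLift p 1 = n) : C(Set.Icc (0 : ℝ) n, K.Geom) where
  toFun t := (reparam p (phaseAut hp hn).symm).extend (t / n)
  continuous_toFun := (Path.continuous_extend _).comp (by fun_prop)

theorem extend_naturalize {p : Path (K.vertex α) (K.vertex β)}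
    (hp : (tameRegularRealization.obj K).IsExec p) {n : ℕ+} (hn : phaseLift p 1 = n) {t : ℝ}
    (ht : t ∈ Set.Icc (0 : ℝ) n) :
    extend (naturalize hp hn) t = (reparam p (phaseAut hp hn).symm).extend (t / n) :=
  extend_apply _ (⟨t, ht⟩ : Set.Icc (0 : ℝ) n)

/-- The reparametrized path is still an execution path, so its restriction to `[0,t]` is a `d`-path
of some length. Comparison with a lift of the phase then shows that this length is `t`. -/
theorem naturalize_mem {p : Path (K.vertex α) (K.vertex β)}
    (hp : (tameRegularRealization.obj K).IsExec p) {n : ℕ+} (hn : phaseLift p 1 = n) :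
    naturalize hp hn ∈ K.naturalPaths n α β := by
  have hpos : (0 : ℝ) < n := Nat.cast_pos.2 n.pos
  have hq := MdTop.reparam_mem _ (phaseAut hp hn).symm hp
  refine ⟨⟨_, hq, fun t ↦ rfl⟩, fun t ht ↦ ?_⟩
  obtain ⟨s, hs⟩ := exists_hasL1Length hq
  obtain ⟨s', hs'⟩ := hs.restrict le_rfl (div_nonneg ht.1 hpos.le)
    (div_le_one_of_le₀ ht.2 hpos.le)
  have h := hs'.comp_monotoneOn (γ' := extend (naturalize hp hn)) (φ := fun r ↦ r / n) ht.1
    (by fun_prop) (fun r _ r' _ hr ↦ div_le_div_of_nonneg_right hr hpos.le) (zero_div _) rfl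
    fun r hr ↦ extend_naturalize hp hn ⟨hr.1, hr.2.trans ht.2⟩
  -- The parameter `r` itself lifts the phase: the inverse of `phaseAut` sends `r / n` to the time
  -- at which `phaseLift p` equals `r`.
  have e := h.eq_sub (F := fun r ↦ r) continuousOn_id fun r hr ↦ by
    have hr' : r / n ∈ I :=
      ⟨div_nonneg hr.1 hpos.le, div_le_one_of_le₀ (hr.2.trans ht.2) hpos.le⟩
    rw [extend_naturalize hp hn ⟨hr.1, hr.2.trans ht.2⟩, Path.extend_apply _ hr', reparam_apply,
      ← coe_phaseLift]
    congr 1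
    have := phaseAut_apply hp hn ((phaseAut hp hn).symm ⟨r / n, hr'⟩)
    rw [OrderIso.apply_symm_apply] at this
    exact (div_left_inj' hpos.ne').1 this
  rw [sub_zero] at e
  rwa [e] at h

/-! ## From natural paths to traces -/

/-- The state of the realization given by a vertex. -/
def state (α : K.cubes 0) : (tameRegularRealization.obj K).states :=
  ⟨K.vertex α, K.vertex_mem_states α⟩

theorem state_bijective (K : PrecubicalSet.{u}) :
    Function.Bijective (state : K.cubes 0 → (tameRegularRealization.obj K).states) :=
  ⟨fun _ _ h ↦ K.vertex_injective (congrArg Subtype.val h), fun ⟨_, hx⟩ ↦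
    (K.exists_vertex_of_mem_states hx).imp fun _ h ↦ Subtype.ext h⟩

namespace NaturalPath

variable {n : ℕ+}

/-- The path parametrized by `[0,1]` given by a natural path. -/
def unit (c : K.NaturalPath n α β) : Path (K.vertex α) (K.vertex β) where
  toFun t := extend c.path (n * t)
  continuous_toFun := (continuous_extend _).comp (by fun_prop)
  source' := by simpa using naturalPaths_source c.mem
  target' := by simpa using naturalPaths_target c.mem

theorem unit_apply (c : K.NaturalPath n α β) (t : I) : c.unit t = extend c.path (n * t) := rfl

theorem extend_eq_unit (c : K.NaturalPath n α β) {t : ℝ} (ht : t ∈ Set.Icc (0 : ℝ) n) :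
    extend c.path t = c.unit.extend (t / n) := by
  have hpos : (0 : ℝ) < n := Nat.cast_pos.2 n.pos
  rw [Path.extend_apply _ ⟨div_nonneg ht.1 hpos.le, div_le_one_of_le₀ ht.2 hpos.le⟩, unit_apply]
  congr 1
  change t = n * (t / n)
  field_simp

theorem isExec_unit (c : K.NaturalPath n α β) : (tameRegularRealization.obj K).IsExec c.unit := by
  obtain ⟨p, hp, e⟩ := c.mem.1
  have hpos : (0 : ℝ) < n := Nat.cast_pos.2 n.pos
  refine hp.congr fun t ↦ ?_
  have ht : (n : ℝ) * t ∈ Set.Icc (0 : ℝ) n :=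
    ⟨mul_nonneg hpos.le t.2.1, mul_le_of_le_one_right hpos.le t.2.2⟩
  rw [unit_apply, show extend c.path (n * t) = _ from (extend_apply c.path ⟨_, ht⟩).trans (e _)]
  rw [mul_div_cancel_left₀ _ hpos.ne', Path.extend_extends']

/-- Along a natural path, the lift of the phase is the parameter. -/
theorem phaseLift_unit (c : K.NaturalPath n α β) (t : I) : phaseLift c.unit t = n * t := by
  have hpos : (0 : ℝ) < n := Nat.cast_pos.2 n.pos
  have ht : (n : ℝ) * t ∈ Set.Icc (0 : ℝ) n :=
    ⟨mul_nonneg hpos.le t.2.1, mul_le_of_le_one_right hpos.le t.2.2⟩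
  -- The lift along `c.unit`, transported to `[0,n]` and extended by constants. The natural path has
  -- length `n * t` on `[0, n * t]`, and this length is the increment of `F`.
  let F : ℝ → ℝ := fun r ↦ phaseLift c.unit (Set.projIcc 0 1 zero_le_one (r / n))
  have h := (c.mem.2 _ ht).eq_sub (F := F)
    ((phaseLift c.unit).continuous.comp (continuous_projIcc.comp (by fun_prop))).continuousOn
    fun r hr ↦ by
      rw [coe_phaseLift, extend_eq_unit c ⟨hr.1, hr.2.trans ht.2⟩]
      rfl
  simp only [F, mul_div_cancel_left₀ _ hpos.ne', Set.projIcc_val, zero_div, Set.projIcc_left] at h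
  rw [show (⟨0, Set.left_mem_Icc.2 zero_le_one⟩ : I) = 0 from rfl, phaseLift_zero, sub_zero] at h
  exact h.symm

/-- The execution path given by a natural path. -/
def toExec (c : K.NaturalPath n α β) :
    (tameRegularRealization.obj K).ExecPath (state α) (state β) :=
  MdTop.ExecPath.mk c.unit c.isExec_unit

theorem continuous_unit : Continuous (unit : K.NaturalPath n α β → _) := by
  rw [Path.continuous_uncurry_iff.symm]
  exact continuous_extend_path.comp (continuous_fst.prodMk (by fun_prop))

theorem continuous_toExec : Continuous (toExec : K.NaturalPath n α β → _) :=
  DeltaContinuous.continuous (MdTop.ExecPath.deltaContinuous_mk continuous_unit _)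

end NaturalPath

/-- The class of the execution path given by a natural path. -/
def toTrace (x : Σ n : ℕ+, K.NaturalPath n α β) :
    (tameRegularRealization.obj K).Trace (state α) (state β) :=
  Quotient.mk _ x.2.toExec

theorem continuous_toTrace : Continuous (toTrace : (Σ n : ℕ+, K.NaturalPath n α β) → _) :=
  continuous_sigma fun _ ↦ (isQuotientMap_quotient_mk'
    (s := MdTop.reparamSetoid _ _ _)).continuous.comp NaturalPath.continuous_toExec

/-- If `d.unit` is `c.unit` reparametrized by `φ`, then `m * φ t` and `n * t` are both lifts of the
phase along `d.unit` that start at 0, hence equal. The value at `t = 1` gives `m = n`, and then `φ`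
is the identity. -/
theorem toTrace_injective : Function.Injective (toTrace (K := K) (α := α) (β := β)) := by
  rintro ⟨m, c⟩ ⟨n, d⟩ h
  obtain ⟨φ, hφ⟩ := Quotient.exact (s := MdTop.reparamSetoid _ _ _) h
  change d.unit = reparam c.unit φ at hφ
  have hm : (0 : ℝ) < m := Nat.cast_pos.2 m.pos
  have hn : (0 : ℝ) < n := Nat.cast_pos.2 n.pos
  have e : (fun t : I ↦ (m : ℝ) * φ t) = phaseLift d.unit :=
    eq_phaseLift (by have := φ.continuous; fun_prop) (fun t ↦ by
      rw [← NaturalPath.phaseLift_unit, coe_phaseLift, hφ, reparam_apply])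
      (by rw [show φ 0 = 0 from φ.map_bot]; simp)
  have e' : ∀ t : I, (m : ℝ) * φ t = n * t := fun t ↦ by
    rw [congrFun e t, NaturalPath.phaseLift_unit]
  have hmn : m = n := by
    have := e' 1
    rw [show φ 1 = 1 from φ.map_top] at this
    simpa using this
  subst hmn
  have hid : ∀ t, φ t = t := fun t ↦ Subtype.ext (mul_left_cancel₀ hm.ne' (e' t))
  congr 1
  refine NaturalPath.ext (ContinuousMap.ext fun t ↦ ?_)
  rw [← extend_apply, ← extend_apply, c.extend_eq_unit t.2, d.extend_eq_unit t.2, hφ]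
  congr 2
  ext t
  rw [reparam_apply, hid]

/-! ## From execution paths to natural paths -/

/-- The natural path that is a reparametrization of a given execution path. -/
def ofExec (c : (tameRegularRealization.obj K).ExecPath (state α) (state β)) :
    Σ n : ℕ+, K.NaturalPath n α β :=
  ⟨(exists_phaseLift_one c.isExec).choose, NaturalPath.mk _
    (naturalize_mem c.isExec (exists_phaseLift_one c.isExec).choose_spec)⟩

/-- The length is determined by the final value of the lift, so the chosen one can be replaced by
any given `n`, for example one common to a whole family of paths. -/
theorem ofExec_eq (c : (tameRegularRealization.obj K).ExecPath (state α) (state β)) {n : ℕ+}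
    (hn : phaseLift (α := α) (y := K.vertex β) c.path 1 = n) :
    ofExec c = ⟨n, NaturalPath.mk _ (naturalize_mem c.isExec hn)⟩ := by
  have h := (exists_phaseLift_one c.isExec).choose_spec
  obtain rfl : n = (exists_phaseLift_one c.isExec).choose := by
    have := hn.symm.trans h
    exact_mod_cast this
  rfl

/-- Rescaled to `[0,1]`, the natural path of `c` is `c` composed with the inverse of `phaseAut`,
hence in the class of `c`. -/
theorem toTrace_ofExec (c : (tameRegularRealization.obj K).ExecPath (state α) (state β)) :
    toTrace (ofExec c) = Quotient.mk _ c := by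
  obtain ⟨n, hn⟩ := exists_phaseLift_one c.isExec
  rw [ofExec_eq c hn]
  have hpos : (0 : ℝ) < n := Nat.cast_pos.2 n.pos
  refine (Quotient.sound (s := MdTop.reparamSetoid _ _ _) ⟨(phaseAut c.isExec hn).symm, ?_⟩).symm
  refine Path.ext (funext fun t ↦ ?_)
  have ht : (n : ℝ) * t ∈ Set.Icc (0 : ℝ) n :=
    ⟨mul_nonneg hpos.le t.2.1, mul_le_of_le_one_right hpos.le t.2.2⟩
  refine (extend_naturalize c.isExec hn ht).trans ?_
  rw [mul_div_cancel_left₀ _ hpos.ne', Path.extend_extends']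
  rfl

/-- The source is `Δ`-generated, so continuity is tested along continuous maps from `ℝ^k`. There the
final value of the lift is continuous and integer-valued, hence constant, so the family stays in one
summand of the coproduct. In that summand it remains to see that evaluating the inversely
reparametrized paths is jointly continuous in the parameter and in time. -/
theorem continuous_ofExec : Continuous (ofExec (K := K) (α := α) (β := β)) := by
  refine DeltaContinuous.continuous fun k f ↦ ?_
  let p : (Fin k → ℝ) → Path (K.vertex α) (K.vertex β) := fun u ↦ (f u).path
  have hp : Continuous p := MdTop.ExecPath.continuous_path.comp f.continuous
  have hL := continuous_phaseLift hp
  obtain ⟨n, hn⟩ := exists_phaseLift_one (f 0).isExec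
  have hn' : ∀ u, phaseLift (p u) 1 = n := by
    intro u
    have hd : _root_.IsDiscrete (Set.range ((↑) : ℤ → ℝ)) :=
      Int.isClosedEmbedding_coe_real.isInducing.isDiscrete_range
    rw [← hn]
    refine isPreconnected_univ.constant_of_mapsTo hd (f := fun u ↦ phaseLift (p u) 1)
      (hL.comp (continuous_id.prodMk continuous_const)).continuousOn (fun u _ ↦ ?_)
      (Set.mem_univ u) (Set.mem_univ 0)
    obtain ⟨m, hm⟩ := exists_phaseLift_one (f u).isExec
    exact ⟨(m : ℕ), by simpa using hm.symm⟩
  have e : (fun u ↦ ofExec (f u)) = fun u ↦ (⟨n, NaturalPath.mk _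
      (naturalize_mem (f u).isExec (hn' u))⟩ : Σ n : ℕ+, K.NaturalPath n α β) :=
    funext fun u ↦ ofExec_eq _ (hn' u)
  change Continuous fun u ↦ ofExec (f u)
  rw [e]
  refine continuous_sigmaMk.comp (DeltaContinuous.continuous (NaturalPath.deltaContinuous_mk
    (ContinuousMap.continuous_of_continuous_uncurry _ ?_) _))
  have hφ : Continuous fun x : (Fin k → ℝ) × I ↦ phaseAut (f x.1).isExec (hn' x.1) x.2 :=
    Continuous.subtype_mk (hL.div_const _) _
  have hev : Continuous fun x : (Fin k → ℝ) × I ↦ p x.1 x.2 :=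
    continuous_eval.comp ((hp.comp continuous_fst).prodMk continuous_snd)
  have hs := continuous_symm_family (φ := fun u ↦ phaseAut (f u).isExec (hn' u)) hφ
  have hr : Continuous fun x : (Fin k → ℝ) × Set.Icc (0 : ℝ) n ↦ (x.2 : ℝ) / n := by fun_prop
  exact hev.comp (continuous_fst.prodMk (hs.comp (continuous_fst.prodMk
    ((continuous_projIcc (h := zero_le_one)).comp hr))))

/-- The map `ofExec` is invariant under reparametrization because `toTrace` is injective and
`toTrace (ofExec c)` is the class of `c`. The induced map on the quotient is the continuous inverse.
-/
theorem isHomeomorph_toTrace : IsHomeomorph (toTrace (K := K) (α := α) (β := β)) := by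
  rw [isHomeomorph_iff_exists_inverse]
  let g : (tameRegularRealization.obj K).Trace (state α) (state β) →
      Σ n : ℕ+, K.NaturalPath n α β :=
    Quotient.lift ofExec fun c d h ↦ toTrace_injective (by
      rw [toTrace_ofExec, toTrace_ofExec]; exact Quotient.sound h)
  have hr : Function.RightInverse g toTrace := fun x ↦ by
    induction x using Quotient.inductionOn with | _ x
    exact toTrace_ofExec x
  exact ⟨continuous_toTrace, g, fun x ↦ toTrace_injective (hr _), hr,
    (isQuotientMap_quotient_mk' (s := MdTop.reparamSetoid _ _ _)).continuous_iff.2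
      continuous_ofExec⟩

end PrecubicalSet

/-! ## Isomorphisms of flows -/

namespace Flow

/-- Heterogeneous equality is needed because the path spaces of the target depend on the images of
the states, which are only propositionally equal. -/
theorem hom_ext {X Y : Flow.{u}} {f g : X ⟶ Y} (hs : ∀ α, f.onStates α = g.onStates α)
    (hp : ∀ {α β : X.states} (x : X.path α β), HEq (f.onPaths x) (g.onPaths x)) : f = g := by
  obtain ⟨fs, fp, fc, fm⟩ := f
  obtain ⟨gs, gp, gc, gm⟩ := g
  obtain rfl : fs = gs := funext hs
  have : @fp = @gp := by
    funext α β x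
    exact eq_of_heq (hp x)
  subst this
  rfl

variable {X Y : Flow.{u}}

/-- Transport of the execution paths along equalities of states. -/
def castPath {α β α' β' : Y.states} (hα : α = α') (hβ : β = β') (x : Y.path α β) : Y.path α' β' :=
  hα ▸ hβ ▸ x

theorem castPath_heq {α β α' β' : Y.states} (hα : α = α') (hβ : β = β') (x : Y.path α β) :
    HEq (castPath hα hβ x) x := by
  subst hα hβ
  rfl

theorem continuous_castPath {α β α' β' : Y.states} (hα : α = α') (hβ : β = β') :
    Continuous (castPath (Y := Y) hα hβ) := by
  subst hα hβ
  exact continuous_id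

theorem castPath_comp {α β γ α' β' γ' : Y.states} (hα : α = α') (hβ : β = β') (hγ : γ = γ')
    (x : Y.path α β) (y : Y.path β γ) :
    castPath hα hγ (Y.comp x y) = Y.comp (castPath hα hβ x) (castPath hβ hγ y) := by
  subst hα hβ hγ
  rfl

theorem onPaths_heq (f : X ⟶ Y) {α β α' β' : X.states} (hα : α = α') (hβ : β = β')
    {x : X.path α β} {x' : X.path α' β'} (h : HEq x x') : HEq (f.onPaths x) (f.onPaths x') := by
  subst hα hβ
  rw [eq_of_heq h]

/-- A map of flows that is bijective on states and a homeomorphism on the spaces of execution paths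
is an isomorphism. -/
theorem isIso_of_isHomeomorph (f : X ⟶ Y) (hs : Function.Bijective f.onStates)
    (hp : ∀ α β : X.states, IsHomeomorph (f.onPaths (α := α) (β := β))) : IsIso f := by
  let e := Equiv.ofBijective f.onStates hs
  have he : ∀ α, f.onStates (e.symm α) = α := e.apply_symm_apply
  let h : ∀ α β : X.states, X.path α β ≃ₜ Y.path (f.onStates α) (f.onStates β) :=
    fun α β ↦ (hp α β).homeomorph
  have hh : ∀ {α β : X.states} (y : Y.path (f.onStates α) (f.onStates β)),
      f.onPaths ((h α β).symm y) = y := fun y ↦ (h _ _).apply_symm_apply y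
  have inj : ∀ {α β : X.states}, Function.Injective (f.onPaths (α := α) (β := β)) :=
    fun {α β} ↦ (hp α β).injective
  -- A path of `Y` is first transported along `f.onStates (e.symm α) = α`, so that it lies in the
  -- target of one of the homeomorphisms. Compatibility with composition is checked after applying
  -- the injective `f.onPaths`.
  let g : Y ⟶ X :=
    { onStates := e.symm
      onPaths := fun y ↦ (h _ _).symm (castPath (he _).symm (he _).symm y)
      continuous_onPaths := fun α β ↦ (h _ _).symm.continuous.comp (continuous_castPath _ _)
      onPaths_comp := fun x y ↦ inj (by
        rw [f.onPaths_comp, hh, hh, hh, castPath_comp]) }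
  have hgf : g ≫ f = 𝟙 Y := hom_ext he fun y ↦
    (heq_of_eq (hh _)).trans (castPath_heq _ _ y)
  refine ⟨g, hom_ext (fun α ↦ e.symm_apply_apply α) fun {α β} x ↦ ?_, hgf⟩
  have hα : e.symm (f.onStates α) = α := e.symm_apply_apply α
  have hβ : e.symm (f.onStates β) = β := e.symm_apply_apply β
  -- The transport puts both arguments into the same path space, so that injectivity of `f.onPaths`
  -- applies.
  have hx : f.onPaths (castPath hα hβ (g.onPaths (f.onPaths x))) = f.onPaths x :=
    eq_of_heq ((onPaths_heq f hα.symm hβ.symm (castPath_heq _ _ _)).trans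
      ((heq_of_eq (hh _)).trans (castPath_heq _ _ _)))
  exact (castPath_heq hα hβ _).symm.trans (heq_of_eq (inj hx))

end Flow

/-- Serves the naturality square, in which the two sides give the same path pointwise but with end
states that are only propositionally equal. -/
theorem MdTop.Trace.mk_heq {X : MdTop.{u}} {α β α' β' : X.states} (hα : α = α') (hβ : β = β')
    {c : X.ExecPath α β} {c' : X.ExecPath α' β'} (h : ∀ t, c.path t = c'.path t) :
    HEq (Quotient.mk (X.reparamSetoid α β) c) (Quotient.mk (X.reparamSetoid α' β') c') := by
  subst hα hβ
  rw [MdTop.ExecPath.ext (Path.ext (funext h))]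

/-! ## The comparison of the tame concrete and the tame regular realizations -/

namespace PrecubicalSet

variable {K : PrecubicalSet.{u}}

/-- Rescaled to `[0,1]`, the Moore composite passes from the first path to the second at `m / (m +
n)`, the normalized composite at `1 / 2`. The piecewise affine automorphism `f`, which sends `1 / 2`
to `m / (m + n)`, turns one into the other. -/
theorem toTrace_sigmaComp {α β γ : K.cubes 0} (x : Σ n : ℕ+, K.NaturalPath n α β)
    (y : Σ n : ℕ+, K.NaturalPath n β γ) :
    toTrace (sigmaComp x y) = MdTop.Trace.comp (toTrace x) (toTrace y) := by
  obtain ⟨m, c⟩ := x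
  obtain ⟨n, d⟩ := y
  have hm : (0 : ℝ) < m := Nat.cast_pos.2 m.pos
  have hn : (0 : ℝ) < n := Nat.cast_pos.2 n.pos
  have hmn : ((m + n : ℕ+) : ℝ) = m + n := by push_cast; rfl
  let f : ℝ → ℝ := fun s ↦ if s ≤ 1 / 2 then 2 * m * s / (m + n)
    else (m + n * (2 * s - 1)) / (m + n)
  have hcont : Continuous f := by
    refine Continuous.if_le (by fun_prop) (by fun_prop) (by fun_prop) (by fun_prop) ?_
    intro s hs
    rw [hs]
    ring
  have hmono : StrictMonoOn f (Set.Icc 0 1) := by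
    intro s _ t _ hst
    simp only [f]
    split_ifs with hs ht ht
    · gcongr
    · refine div_lt_div_of_pos_right ?_ (by linarith)
      have h1 : (m : ℝ) * s ≤ m * (1 / 2) := by gcongr
      have h2 : 0 < (n : ℝ) * (2 * t - 1) := mul_pos hn (by linarith)
      linarith
    · linarith
    · gcongr
  have h0 : f 0 = 0 := by simp [f]
  have h1 : f 1 = 1 := by
    have : ¬ ((1 : ℝ) ≤ 1 / 2) := by norm_num
    simp only [f, if_neg this]
    field_simp
    ring
  refine Quotient.sound (s := MdTop.reparamSetoid _ _ _) ⟨autOfReal f hcont hmono h0 h1, ?_⟩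
  change c.unit.trans d.unit = reparam (c.comp d).unit _
  ext t
  rw [reparam_apply, NaturalPath.unit_apply, autOfReal_apply, NaturalPath.extend_comp, hmn,
    ← Path.extend_extends']
  rcases le_or_gt (t : ℝ) (1 / 2) with ht | ht
  · have hf : ((m : ℝ) + n) * f t = m * (2 * t) := by
      simp only [f, if_pos ht]
      field_simp
    have hI : 2 * (t : ℝ) ∈ I := ⟨by linarith [t.2.1], by linarith⟩
    rw [hf, Path.extend_trans_of_le_half _ _ ht, Path.extend_apply _ hI, NaturalPath.unit_apply,
      if_pos (mul_le_of_le_one_right hm.le hI.2)]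
  · have hf : ((m : ℝ) + n) * f t = m + n * (2 * t - 1) := by
      simp only [f, if_neg (not_le.2 ht)]
      field_simp
    have hI : 2 * (t : ℝ) - 1 ∈ I := ⟨by linarith, by linarith [t.2.2]⟩
    have hlt : ¬ ((m : ℝ) + n * (2 * t - 1) ≤ m) := by
      have : 0 < (n : ℝ) * (2 * t - 1) := mul_pos hn (by linarith)
      linarith
    rw [hf, Path.extend_trans_of_half_le _ _ ht.le, Path.extend_apply _ hI, NaturalPath.unit_apply,
      if_neg hlt, add_sub_cancel_left]

/-- The comparison map from the tame concrete realization to the categorization of the tame regular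
realization. -/
def comparison (K : PrecubicalSet.{u}) :
    tameConcreteRealization.obj K ⟶ (tameRegularRealization ⋙ MdTop.cat).obj K where
  onStates := state
  onPaths := toTrace
  continuous_onPaths _ _ := continuous_toTrace
  onPaths_comp := toTrace_sigmaComp

instance isIso_comparison (K : PrecubicalSet.{u}) : IsIso K.comparison :=
  Flow.isIso_of_isHomeomorph _ K.state_bijective fun _ _ ↦ isHomeomorph_toTrace

theorem comparison_naturality {K L : PrecubicalSet.{u}} (f : K ⟶ L) :
    tameConcreteRealization.map f ≫ L.comparison =
      K.comparison ≫ (tameRegularRealization ⋙ MdTop.cat).map f := by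
  have hs : ∀ α : K.cubes 0, (state (f.app _ α) : (tameRegularRealization.obj L).states) =
      ⟨geomMap f (K.vertex α), (tameRegularRealization.map f).map_states _
        (K.vertex_mem_states α)⟩ :=
    fun α ↦ Subtype.ext (geomMap_cube f α _).symm
  exact Flow.hom_ext hs fun {α β} _ ↦ MdTop.Trace.mk_heq (hs α) (hs β) fun _ ↦ rfl

/-- The categorization of the tame regular realization is naturally isomorphic to the tame concrete
realization. -/
def comparisonIso : tameRegularRealization.{u} ⋙ MdTop.cat ≅ tameConcreteRealization :=
  (NatIso.ofComponents (fun K ↦ asIso K.comparison) comparison_naturality).symm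

end PrecubicalSet

end DirectedSpace

end

theorem mainTheorem9 :
    Nonempty (DirectedSpace.PrecubicalSet.tameRegularRealization.{u} ⋙ DirectedSpace.MdTop.cat.{u} ≅
      DirectedSpace.PrecubicalSet.tameConcreteRealization.{u}) :=
  ⟨DirectedSpace.PrecubicalSet.comparisonIso⟩
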